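/- Let $X$ be a finite $d$-uniform simplicial complex (the family $X(d)$ of top-level faces consists of $d$-sets, and $X(k)$ is the set of all $k$-subsets of top-level faces) with a strictly positive probability density $\Pr_d$ on $X(d)$. Let $\Pr_k(t)=\binom{d}{k}^{-1}\sum_{s\in X(d),\,s\supseteq t}\Pr_d(s)$ be the induced density on $X(k)$; probabilities and expectations on $X(k)$ are with respect to $\Pr_k$. The link $X_s=\{t\setminus s: s\subseteq t\in X\}$ of a face $s$ of size $k$ is $(d-k)$-uniform, with density $t\mapsto \Pr_d(t\cup s)/(\binom{d}{k}\Pr_k(s))$. The graph underlying a complex has its vertices as vertices and its faces of size 2, weighted by their density, as edges; it is a $c$-one-sided expander if the second largest eigenvalue of its normalized adjacency operator is at most $c$. $X$ is $\lambda$-trickling-down ($\lambda$-TD) if the graph underlying the link of every face of size at most $d-2$ (including $\emptyset$) is connected and the graph underlying the link of every face of size $d-2$ is a $\frac{\lambda}{d-1}$-one-sided expander. For $\nu>0$, a function $f:X(k)\to\mathbb R$ is $\nu$-Lipschitz if, with probability $1$ over a random $s\in X(k)$ and over vertices $z_x$ ($x\in s$) drawn independently, $z_x$ from the distribution of the missing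 vertex of a random $k$-face conditioned on the other vertices being $s\setminus\{x\}$, $$\sum_{x\in s}\max\{f(s)-f((s\setminus\{x\})\cup\{z_x\}),0\}^2\le \nu .$$ (a) If $X$ is $\lambda$-TD with $\lambda<1$, then for all $0\le k\le d$, $\nu>0$, every $\nu$-Lipschitz $f:X(k)\to\mathbb R$ and every $t$, $$\Pr[f-\mathbb E f\ge t]\le 2e^{-t/\sqrt{c_\lambda\nu}}\quad\text{and}\quad \Pr[f-\mathbb E f\le -t]\le 2e^{-t/\sqrt{c_\lambda\nu}},\qquad c_\lambda=1+e^{\lambda/(1-\lambda)} .$$ (b) More generally, if $C>0$ and the down-up walk $U_{d-1}D_d$ on $X(d)$ (remove a uniformly random vertex from the face, then draw a random top-level face containing what is left) satisfies $\lambda_2(U_{d-1}D_d)\le 1-\frac1{Cd}$, then for all $0\le k\le d$, $\nu>0$, every $\nu$-Lipschitz $f:X(k)\to\mathbb R$ and every $t$, $$\Pr[f-\mathbb E f\ge t]\le 2e^{-t/\sqrt{(C+1)\nu}}\quad\text{and}\quad \Pr[f-\mathbb E f\le -t]\le 2e^{-t/\sqrt{(C+1)\nu}} .$$ -/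

import Mathlib

open Finset

noncomputable section

/-- A (finite, pure) `d`-uniform simplicial complex on vertices from `V`, endowed with a probability
density on its top-level faces. The complex is the downward closure of the family `top` of
`d`-sets. -/
structure WeightedComplex (V : Type*) [DecidableEq V] (d : ℕ) where
  /-- the top-level faces `X(d)` -/
  top : Finset (Finset V)
  card_of_mem_top : ∀ s ∈ top, s.card = d
  /-- the density `Pr_d` on `X(d)` (its values outside `top` play no role) -/
  density : Finset V → ℝ
  density_pos : ∀ s ∈ top, 0 < density s
  density_sum : ∑ s ∈ top, density s = 1

namespace WeightedComplex

variable {V : Type*} [DecidableEq V] {d : ℕ}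

/-- The set `X(k)` of faces of size `k`: all `k`-subsets of top-level faces. -/
def faces (X : WeightedComplex V d) (k : ℕ) : Finset (Finset V) :=
  X.top.biUnion fun s => s.powersetCard k

/-- The vertices of the complex. -/
def verts (X : WeightedComplex V d) : Finset V :=
  X.top.biUnion id

/-- The induced density `Pr_k` on `X(k)`, at a face `t` of size `k = t.card`: the law of a uniformly
random `k`-subset of a random top-level face. -/
def prob (X : WeightedComplex V d) (t : Finset V) : ℝ :=
  (∑ s ∈ X.top with t ⊆ s, X.density s) / (d.choose t.card : ℝ)

theorem mem_faces {X : WeightedComplex V d} {k : ℕ} {t : Finset V} :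
    t ∈ X.faces k ↔ (∃ s ∈ X.top, t ⊆ s) ∧ t.card = k := by
  simp only [faces, mem_biUnion, mem_powersetCard]
  constructor
  · rintro ⟨s, hs, hts, hc⟩
    exact ⟨⟨s, hs, hts⟩, hc⟩
  · rintro ⟨⟨s, hs, hts⟩, hc⟩
    exact ⟨s, hs, hts, hc⟩

theorem prob_mul_choose (X : WeightedComplex V d) {k : ℕ} {t : Finset V} (ht : t ∈ X.faces k) :
    X.prob t * (d.choose t.card : ℝ) = ∑ s ∈ X.top with t ⊆ s, X.density s := by
  obtain ⟨⟨s, hs, hts⟩, -⟩ := mem_faces.1 ht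
  have hle : t.card ≤ d := X.card_of_mem_top s hs ▸ card_le_card hts
  have hne : (d.choose t.card : ℝ) ≠ 0 := by exact_mod_cast (Nat.choose_pos hle).ne'
  rw [prob, div_mul_cancel₀ _ hne]

theorem prob_mul_choose_pos (X : WeightedComplex V d) {k : ℕ} {t : Finset V}
    (ht : t ∈ X.faces k) : 0 < X.prob t * (d.choose t.card : ℝ) := by
  obtain ⟨⟨s, hs, hts⟩, -⟩ := mem_faces.1 ht
  rw [X.prob_mul_choose ht]
  exact sum_pos (fun u hu => X.density_pos u (mem_filter.1 hu).1) ⟨s, mem_filter.2 ⟨hs, hts⟩⟩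

/-- The link `X_s = {t \ s : t ∈ X, s ⊆ t}` of a face `s`, a complex of uniformity `d - |s|`, with
the density `t ↦ Pr(t ∪ s) / (Pr(s) * binom(d, |s|))`. -/
def link (X : WeightedComplex V d) {k : ℕ} (s : Finset V) (hs : s ∈ X.faces k) :
    WeightedComplex V (d - k) where
  top := (X.top.filter fun t => s ⊆ t).image fun t => t \ s
  card_of_mem_top := by
    intro u hu
    obtain ⟨t, ht, rfl⟩ := mem_image.1 hu
    rw [mem_filter] at ht
    rw [card_sdiff_of_subset ht.2, X.card_of_mem_top t ht.1, (mem_faces.1 hs).2]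
  density t := X.density (t ∪ s) / (X.prob s * (d.choose s.card : ℝ))
  density_pos := by
    intro u hu
    obtain ⟨t, ht, rfl⟩ := mem_image.1 hu
    rw [mem_filter] at ht
    rw [sdiff_union_of_subset ht.2]
    exact div_pos (X.density_pos t ht.1) (X.prob_mul_choose_pos hs)
  density_sum := by
    rw [← sum_div, sum_image, div_eq_one_iff_eq (X.prob_mul_choose_pos hs).ne',
      X.prob_mul_choose hs]
    · refine sum_congr rfl fun t ht => ?_
      rw [sdiff_union_of_subset (mem_filter.1 ht).2]
    · intro a ha b hb hab
      have h : a \ s ∪ s = b \ s ∪ s := congrArg (· ∪ s) hab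
      rwa [sdiff_union_of_subset (mem_filter.1 ha).2,
        sdiff_union_of_subset (mem_filter.1 hb).2] at h

/-! ### The underlying graph -/

/-- The graph underlying a complex: its vertices and its faces of size 2. -/
def graph (X : WeightedComplex V d) : SimpleGraph {v : V // v ∈ X.verts} where
  Adj u v := u ≠ v ∧ ({u.1, v.1} : Finset V) ∈ X.faces 2
  symm := ⟨fun u v h => ⟨h.1.symm, by rw [pair_comm]; exact h.2⟩⟩
  loopless := ⟨fun _ h => h.1 rfl⟩

/-- The weight of the (ordered) pair `u, v` in the graph underlying a complex: the density `Pr_2` of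
the face `{u, v}`, and zero when `{u, v}` is not a face of size 2. -/
def edgeProb (X : WeightedComplex V d) (u v : V) : ℝ :=
  if ({u, v} : Finset V) ∈ X.faces 2 then X.prob {u, v} else 0

/-- The probability of a vertex in the underlying weighted graph. -/
def vertexProb (X : WeightedComplex V d) (v : V) : ℝ :=
  (1 / 2) * ∑ u ∈ X.verts, X.edgeProb v u

/-- The normalized adjacency operator `A f(v) = E_{u ∼ v} f(u)` of the underlying weighted graph. -/
def adjOp (X : WeightedComplex V d) (f : V → ℝ) (v : V) : ℝ :=
  ∑ u ∈ X.verts, X.edgeProb v u / (∑ w ∈ X.verts, X.edgeProb v w) * f u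

end WeightedComplex

/-- `λ₂(A) ≤ c`, for an operator `A` on functions on a finite set `S` that fixes the constants and
is self-adjoint in `ℓ²(S, p)`: every nontrivial eigenvalue of `A`, that is every one which has an
eigenfunction orthogonal to the constants, is at most `c`. Only the values on `S` matter. -/
def SecondEigenvalueLE {α : Type*} (S : Finset α) (p : α → ℝ) (A : (α → ℝ) → α → ℝ) (c : ℝ) :
    Prop :=
  ∀ (μ : ℝ) (f : α → ℝ), ∑ x ∈ S, p x * f x = 0 → (∃ x ∈ S, f x ≠ 0) →
    (∀ x ∈ S, A f x = μ * f x) → μ ≤ c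

namespace WeightedComplex

variable {V : Type*} [DecidableEq V] {d : ℕ}

/-- The graph underlying the complex is a `c`-one-sided spectral expander. -/
def IsOneSidedExpander (X : WeightedComplex V d) (c : ℝ) : Prop :=
  SecondEigenvalueLE X.verts X.vertexProb X.adjOp c

/-- The complex is connected: the graph underlying every link (of co-dimension at least 2, so that
the link does have edges), including the link of the empty face, is connected. -/
def IsConnected (X : WeightedComplex V d) : Prop :=
  ∀ (k : ℕ) (s : Finset V) (hs : s ∈ X.faces k), k + 2 ≤ d → (X.link s hs).graph.Connected

/-- `lam`-trickling-down complexes: connected, and every link of co-dimension 2 is a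
`lam / (d - 1)`-one-sided expander. -/
def IsTricklingDown (X : WeightedComplex V d) (lam : ℝ) : Prop :=
  X.IsConnected ∧
    ∀ (k : ℕ) (s : Finset V) (hs : s ∈ X.faces k), k + 2 = d →
      (X.link s hs).IsOneSidedExpander (lam / ((d : ℝ) - 1))

/-! ### The down-up walk. Functions on `X(k)` are represented by functions on all finite sets of
vertices, of which only the values on `X(k)` matter. -/

/-- The down operator `D_{k,l}`: the expectation of `f(t)` over a random `k`-face `t` containing the
`l`-face `s`. -/
def downOp (X : WeightedComplex V d) (k l : ℕ) (f : Finset V → ℝ) (s : Finset V) : ℝ :=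
  ∑ t ∈ X.faces k with s ⊆ t, X.prob t / ((k.choose l : ℝ) * X.prob s) * f t

/-- The up operator `U_{l,k}`: the expectation of `g(s)` over a uniformly random `l`-subset `s` of
the `k`-face `t`. -/
def upOp (l k : ℕ) (g : Finset V → ℝ) (t : Finset V) : ℝ :=
  (∑ s ∈ t.powersetCard l, g s) / (k.choose l : ℝ)

/-- The down-up walk `U_{k-1} D_k` on `X(k)`. -/
def downUp (X : WeightedComplex V d) (k : ℕ) (f : Finset V → ℝ) : Finset V → ℝ :=
  upOp (k - 1) k (X.downOp k (k - 1) f)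

/-! ### Concentration -/

/-- The expectation of `f` on `X(k)`. -/
def mean (X : WeightedComplex V d) (k : ℕ) (f : Finset V → ℝ) : ℝ :=
  ∑ s ∈ X.faces k, X.prob s * f s

open Classical in
/-- The probability of an event on `X(k)`. -/
def probOf (X : WeightedComplex V d) (k : ℕ) (E : Finset V → Prop) : ℝ :=
  ∑ s ∈ X.faces k with E s, X.prob s

/-- The law of a resampled vertex: given all vertices `r` of a face but one, the probability that
the missing vertex is `y`. -/
def resampleProb (X : WeightedComplex V d) (r : Finset V) (y : V) : ℝ :=
  if y ∈ r then 0
  else X.prob (insert y r) / ∑ y' ∈ X.verts \ r, X.prob (insert y' r)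

/-- `f` is `ν`-Lipschitz on `X(k)`: with probability 1 over the random face `s ∈ X(k)` and over the
independent resamplings `z x` of its vertices `x ∈ s`, each conditional on `s \ {x}`,
`∑_{x ∈ s} (f(s) - f(s \ {x} ∪ {z x}))₊² ≤ ν`. All probability spaces being finite, this says that
the inequality holds at every outcome of positive probability. -/
def IsLipschitz (X : WeightedComplex V d) (k : ℕ) (ν : ℝ) (f : Finset V → ℝ) : Prop :=
  ∀ s ∈ X.faces k, ∀ z : V → V, (∀ x ∈ s, 0 < X.resampleProb (s.erase x) (z x)) →
    ∑ x ∈ s, (max (f s - f (insert (z x) (s.erase x))) 0) ^ 2 ≤ ν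

end WeightedComplex

end

/-!
Both parts reduce to a Poincaré inequality for the down-up walk on the top-level faces
(`WeightedComplex.HasPoincare`): the variance of any function is at most `C` times the sum of the
variances that remain after conditioning on all vertices of the face but one.

In part (b) this is the hypothesis on the second eigenvalue, read as a bound on the quadratic form
(`SecondEigenvalueLE.sum_mul_le`). In part (a), the trickling-down theorem
(`WeightedComplex.LinkGapLE.of_insert`) carries the expansion of the links of codimension 2 to those
of codimension `i + 2`, whose second eigenvalue is at most `λ / (d - 1 - i λ)`. Conditioning on one
vertex at a time multiplies the Poincaré constant by one over the spectral gap of the corresponding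
link (`WeightedComplex.LinkGapLE.mul_starVar_le`), and the product of these factors telescopes to
`1 / (1 - λ) ≤ e^{λ/(1-λ)}`.

Suppose that resampling the vertices of a `k`-face `s` lowers `g` by amounts whose squares add up to
at most `w s`, whatever the resampled values. Then `Var g ≤ c E w` on every level `X(k)`, provided
that `c ≥ 1` is a Poincaré constant at the top level (`WeightedComplex.HasPoincare.variance_le`). On
the way down from the top, the variance of `g` on `X(k)` is split into the variance of its averages
over the `k`-subsets of a `(k + 1)`-face and the mean variance over these subsets. Averaging
contracts the bound by `k / (k + 1)`, and the variance over the subsets is at most `1 / (k + 1)` of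
it. It is here that the Lipschitz condition is needed for all resamplings of positive probability, and
not only on average: exchanging two vertices of a random `(k + 1)`-face has another law than a step
of the down-up walk on `X(k)`.

Let `Y = ± (f - E f) / √(c ν)` and let `M(θ) = E e^{θ Y}`. The variance bound for `± e^{θ Y / 2}`
reads `M(θ) - M(θ/2)² ≤ (e^{θ/2} - 1)² M(θ)`. It serves the lower tail as well as the upper one,
although the Lipschitz condition is one-sided, because the decrements of `Y` are at most `1`.
Iterating it gives `M(1) ≤ 5/2` (`sum_mul_exp_le_of_recursion`). As `Var Y ≤ 1` and `E Y = 0`, this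
still yields `P(Y ≥ τ) ≤ 2 e^{-τ}` (`sum_filter_le_two_mul_exp_neg`): Cantelli's inequality covers
the small `τ`, and Markov's inequality for `e^Y - 1 - Y` the large ones.
-/

noncomputable section

/-! ### From eigenvalues to quadratic forms -/

/-- The bound on the nontrivial eigenvalues of a self-adjoint operator that fixes the constants,
as a bound on its quadratic form on the functions of mean zero. Multiplication by `√p` turns the
operator into a symmetric one on a Euclidean space, where the orthogonal complement of `√p` is
invariant and has a basis of eigenvectors. -/
theorem SecondEigenvalueLE.sum_mul_le {α : Type*} {S : Finset α} {p : α → ℝ}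
    {A : (α → ℝ) → α → ℝ} {c : ℝ} (h : SecondEigenvalueLE S p A c) (hp : ∀ x ∈ S, 0 < p x)
    (hcongr : ∀ f g : α → ℝ, (∀ x ∈ S, f x = g x) → ∀ x ∈ S, A f x = A g x)
    (hadd : ∀ f g : α → ℝ, ∀ x ∈ S, A (f + g) x = A f x + A g x)
    (hsmul : ∀ (a : ℝ) (f : α → ℝ), ∀ x ∈ S, A (a • f) x = a * A f x)
    (hsymm : ∀ f g : α → ℝ, ∑ x ∈ S, p x * (f x * A g x) = ∑ x ∈ S, p x * (A f x * g x))
    (hone : ∀ x ∈ S, A (fun _ => 1) x = 1) (f : α → ℝ) (hf : ∑ x ∈ S, p x * f x = 0) :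
    ∑ x ∈ S, p x * (f x * A f x) ≤ c * ∑ x ∈ S, p x * f x ^ 2 := by
  classical
  let ext : EuclideanSpace ℝ S → α → ℝ := fun u x =>
    if hx : x ∈ S then u ⟨x, hx⟩ / √(p x) else 0
  have hsq : ∀ x ∈ S, √(p x) * √(p x) = p x := fun x hx => Real.mul_self_sqrt (hp x hx).le
  have hpos : ∀ x ∈ S, 0 < √(p x) := fun x hx => Real.sqrt_pos.2 (hp x hx)
  have hext : ∀ (u : EuclideanSpace ℝ S) (x : S), ext u x = u x / √(p x) := fun u x => by
    simp [ext]
  have hext' : ∀ (u : EuclideanSpace ℝ S) (x : S), u x = √(p x) * ext u x := fun u x => by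
    rw [hext, mul_div_cancel₀ _ (hpos x x.2).ne']
  let T : EuclideanSpace ℝ S →ₗ[ℝ] EuclideanSpace ℝ S :=
    { toFun := fun u => WithLp.toLp 2 fun x : S => √(p x) * A (ext u) x
      map_add' := fun u v => by
        ext x
        have : ext (u + v) = ext u + ext v := by
          funext y
          by_cases hy : y ∈ S <;> simp [ext, hy, add_div]
        simp [this, hadd _ _ _ x.2, mul_add]
      map_smul' := fun a u => by
        ext x
        have : ext (a • u) = a • ext u := by
          funext y
          by_cases hy : y ∈ S <;> simp [ext, hy, mul_div_assoc]
        simp [this, hsmul _ _ _ x.2, mul_left_comm] }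
  have hT : ∀ (u : EuclideanSpace ℝ S) (x : S), T u x = √(p x) * A (ext u) x := fun _ _ => rfl
  have hinner : ∀ u v : EuclideanSpace ℝ S,
      inner ℝ u v = ∑ x ∈ S, p x * (ext u x * ext v x) := fun u v => by
    rw [← sum_coe_sort S, PiLp.inner_apply]
    refine sum_congr rfl fun x _ => ?_
    rw [hext' u, hext' v, ← hsq x x.2]
    simp
    ring
  have hextT : ∀ (u : EuclideanSpace ℝ S), ∀ x ∈ S, ext (T u) x = A (ext u) x := fun u x hx => by
    rw [hext (T u) ⟨x, hx⟩, hT, mul_div_cancel_left₀ _ (hpos x hx).ne']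
  have hsym : T.IsSymmetric := fun u v => by
    rw [hinner, hinner, sum_congr rfl fun x hx => by rw [hextT u x hx],
      ← hsymm, sum_congr rfl fun x hx => by rw [← hextT v x hx]]
  let e : EuclideanSpace ℝ S := WithLp.toLp 2 fun x : S => √(p x)
  have he : ∀ x ∈ S, ext e x = 1 := fun x hx => by
    rw [hext e ⟨x, hx⟩]
    exact div_self (hpos x hx).ne'
  have hTe : T e = e := by
    ext x
    rw [hT, hcongr (ext e) (fun _ => 1) he x x.2, hone x x.2, mul_one]
  have hK : ∀ u : EuclideanSpace ℝ S, u ∈ (ℝ ∙ e)ᗮ ↔ ∑ x ∈ S, p x * ext u x = 0 := fun u => by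
    rw [Submodule.mem_orthogonal_singleton_iff_inner_right, hinner,
      sum_congr rfl fun x hx => by rw [he x hx, one_mul]]
  have hinv : ∀ u ∈ (ℝ ∙ e)ᗮ, T u ∈ (ℝ ∙ e)ᗮ := fun u hu => by
    rw [Submodule.mem_orthogonal_singleton_iff_inner_right] at hu ⊢
    rw [← hsym, hTe, hu]
  have hsymK := hsym.restrict_invariant hinv
  let b := hsymK.eigenvectorBasis rfl
  have heig : ∀ i, hsymK.eigenvalues rfl i ≤ c := fun i => by
    have hb := hsymK.apply_eigenvectorBasis rfl i
    have hne : (b i : EuclideanSpace ℝ S) ≠ 0 := fun h0 =>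
      b.orthonormal.ne_zero i (Subtype.ext h0)
    have hb' : T (b i) = hsymK.eigenvalues rfl i • (b i : EuclideanSpace ℝ S) :=
      congrArg Subtype.val hb
    refine h _ (ext (b i)) ((hK _).1 (b i).2) ?_ fun x hx => ?_
    · by_contra! h0
      exact hne (by ext x; rw [hext', h0 x x.2, mul_zero]; rfl)
    · rw [← hextT _ x hx, hb', hext _ ⟨x, hx⟩, hext _ ⟨x, hx⟩]
      simp [mul_div_assoc]
  let u₀ : EuclideanSpace ℝ S := WithLp.toLp 2 fun x : S => √(p x) * f x
  have hu₀ : ∀ x ∈ S, ext u₀ x = f x := fun x hx => by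
    rw [hext _ ⟨x, hx⟩]
    exact mul_div_cancel_left₀ _ (hpos x hx).ne'
  have hu₀K : u₀ ∈ (ℝ ∙ e)ᗮ := (hK _).2 <| by
    rw [sum_congr rfl fun x hx => by rw [hu₀ x hx], hf]
  let u : ((ℝ ∙ e)ᗮ : Submodule ℝ (EuclideanSpace ℝ S)) := ⟨u₀, hu₀K⟩
  have key : inner ℝ u (T.restrict hinv u) ≤ c * inner ℝ u u := by
    rw [← b.sum_inner_mul_inner u (T.restrict hinv u), ← b.sum_inner_mul_inner u u, mul_sum]
    refine sum_le_sum fun i _ => ?_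
    have h1 : inner ℝ (b i) (T.restrict hinv u) = hsymK.eigenvalues rfl i * inner ℝ (b i) u := by
      rw [← hsymK, hsymK.apply_eigenvectorBasis rfl i]
      exact real_inner_smul_left _ _ _
    rw [h1, real_inner_comm u (b i)]
    nlinarith [mul_le_mul_of_nonneg_right (heig i) (mul_self_nonneg (inner ℝ u (b i)))]
  have k1 : inner ℝ u (T.restrict hinv u) = ∑ x ∈ S, p x * (f x * A f x) := by
    change inner ℝ u₀ (T u₀) = _
    rw [hinner]
    refine sum_congr rfl fun x hx => ?_
    rw [hextT _ x hx, hu₀ x hx, hcongr _ f hu₀ x hx]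
  have k2 : inner ℝ u u = ∑ x ∈ S, p x * f x ^ 2 := by
    change inner ℝ u₀ u₀ = _
    rw [hinner]
    refine sum_congr rfl fun x hx => ?_
    rw [hu₀ x hx, sq]
  rwa [k1, k2] at key

/-! ### Sums over stars and double counting -/

namespace WeightedComplex

variable {V : Type*} [DecidableEq V] {d : ℕ} (X : WeightedComplex V d)

/-- The integral of `F` over the star of `t`, that is over the top-level faces containing `t`,
against the (not renormalized) density. -/
def starSum (t : Finset V) (F : Finset V → ℝ) : ℝ :=
  ∑ s ∈ X.top with t ⊆ s, X.density s * F s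

/-- The total density of the star of `t`. -/
def starWeight (t : Finset V) : ℝ :=
  ∑ s ∈ X.top with t ⊆ s, X.density s

/-- The integral over the star of `t` of the squared deviation of `F` from its mean there: the
conditional variance of `F` given that the random top-level face contains `t`, times the
probability of that event. -/
def starVar (t : Finset V) (F : Finset V → ℝ) : ℝ :=
  X.starSum t (fun s => F s ^ 2) - X.starSum t F ^ 2 / X.starWeight t

variable {X}

theorem starSum_const (t : Finset V) (a : ℝ) : X.starSum t (fun _ => a) = a * X.starWeight t := by
  rw [starSum, starWeight, mul_comm, sum_mul]

theorem starSum_add (t : Finset V) (F G : Finset V → ℝ) :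
    X.starSum t (fun s => F s + G s) = X.starSum t F + X.starSum t G := by
  simp only [starSum, mul_add, sum_add_distrib]

theorem starSum_sub (t : Finset V) (F G : Finset V → ℝ) :
    X.starSum t (fun s => F s - G s) = X.starSum t F - X.starSum t G := by
  simp only [starSum, mul_sub, sum_sub_distrib]

theorem starSum_const_mul (t : Finset V) (a : ℝ) (F : Finset V → ℝ) :
    X.starSum t (fun s => a * F s) = a * X.starSum t F := by
  simp only [starSum, mul_sum, mul_left_comm]

theorem starSum_congr {t : Finset V} {F G : Finset V → ℝ}
    (h : ∀ s ∈ X.top, t ⊆ s → F s = G s) : X.starSum t F = X.starSum t G :=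
  sum_congr rfl fun s hs => by rw [h s (mem_filter.1 hs).1 (mem_filter.1 hs).2]

theorem starSum_mono {t : Finset V} {F G : Finset V → ℝ}
    (h : ∀ s ∈ X.top, t ⊆ s → F s ≤ G s) : X.starSum t F ≤ X.starSum t G :=
  sum_le_sum fun s hs => mul_le_mul_of_nonneg_left (h s (mem_filter.1 hs).1 (mem_filter.1 hs).2)
    (X.density_pos s (mem_filter.1 hs).1).le

theorem starSum_nonneg {t : Finset V} {F : Finset V → ℝ}
    (h : ∀ s ∈ X.top, t ⊆ s → 0 ≤ F s) : 0 ≤ X.starSum t F :=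
  sum_nonneg fun s hs => mul_nonneg (X.density_pos s (mem_filter.1 hs).1).le
    (h s (mem_filter.1 hs).1 (mem_filter.1 hs).2)

theorem starSum_of_not_subset {t : Finset V} (h : ∀ s ∈ X.top, ¬ t ⊆ s) (F : Finset V → ℝ) :
    X.starSum t F = 0 := by
  rw [starSum, filter_false_of_mem h, sum_empty]

theorem starWeight_eq_starSum (t : Finset V) : X.starWeight t = X.starSum t fun _ => 1 := by
  rw [starSum_const, one_mul]

theorem starWeight_of_not_subset {t : Finset V} (h : ∀ s ∈ X.top, ¬ t ⊆ s) :
    X.starWeight t = 0 := by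
  rw [starWeight, filter_false_of_mem h, sum_empty]

theorem starWeight_nonneg (t : Finset V) : 0 ≤ X.starWeight t :=
  sum_nonneg fun s hs => (X.density_pos s (mem_filter.1 hs).1).le

theorem starWeight_pos {t s : Finset V} (hs : s ∈ X.top) (h : t ⊆ s) : 0 < X.starWeight t :=
  sum_pos (fun u hu => X.density_pos u (mem_filter.1 hu).1) ⟨s, mem_filter.2 ⟨hs, h⟩⟩

theorem exists_subset_of_starWeight_pos {t : Finset V} (h : 0 < X.starWeight t) :
    ∃ s ∈ X.top, t ⊆ s := by
  by_contra! hc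
  rw [starWeight_eq_starSum, starSum_of_not_subset hc] at h
  exact h.false

theorem starWeight_eq_zero_or_pos (t : Finset V) :
    (∀ s ∈ X.top, ¬ t ⊆ s) ∨ 0 < X.starWeight t := by
  by_cases h : ∃ s ∈ X.top, t ⊆ s
  · obtain ⟨s, hs, hts⟩ := h
    exact Or.inr (starWeight_pos hs hts)
  · push Not at h
    exact Or.inl h

theorem starWeight_empty : X.starWeight ∅ = 1 := by
  simp [starWeight, X.density_sum]

theorem mem_faces_iff_starWeight_pos {t : Finset V} {k : ℕ} :
    t ∈ X.faces k ↔ 0 < X.starWeight t ∧ t.card = k := by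
  rw [mem_faces]
  exact and_congr_left fun _ =>
    ⟨fun ⟨_, hs, h⟩ => starWeight_pos hs h, exists_subset_of_starWeight_pos⟩

theorem top_subset_verts {s : Finset V} (hs : s ∈ X.top) : s ⊆ X.verts :=
  fun _ hv => mem_biUnion.2 ⟨s, hs, hv⟩

/-- The double counting identity behind all the averaging over links: choosing a vertex outside
`t` and then a top-level face containing both amounts to choosing a top-level face containing `t`
and then one of its remaining vertices. -/
theorem sum_starSum_insert (t : Finset V) (F : V → Finset V → ℝ) :
    ∑ v ∈ X.verts \ t, X.starSum (insert v t) (F v) =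
      X.starSum t fun s => ∑ v ∈ s \ t, F v s := by
  simp only [starSum, mul_sum]
  refine sum_comm' fun v s => ?_
  simp only [mem_sdiff, mem_filter, insert_subset_iff]
  exact ⟨fun ⟨⟨_, h2⟩, h3, h4, h5⟩ => ⟨⟨h4, h2⟩, h3, h5⟩,
    fun ⟨⟨h4, h2⟩, h3, h5⟩ => ⟨⟨top_subset_verts h3 h4, h2⟩, h3, h4, h5⟩⟩

theorem card_sdiff_of_mem_top {t s : Finset V} (hs : s ∈ X.top) (hts : t ⊆ s) :
    ((s \ t).card : ℝ) = (d : ℝ) - t.card := by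
  rw [card_sdiff_of_subset hts, Nat.cast_sub (card_le_card hts), X.card_of_mem_top s hs]

theorem starSum_mul_sq_le (t : Finset V) (F G : Finset V → ℝ) :
    X.starSum t (fun s => F s * G s) ^ 2 ≤
      X.starSum t (fun s => F s ^ 2) * X.starSum t fun s => G s ^ 2 := by
  have h := sum_mul_sq_le_sq_mul_sq (X.top.filter (t ⊆ ·)) (fun s => √(X.density s) * F s)
    fun s => √(X.density s) * G s
  have hsq : ∀ s ∈ X.top.filter (t ⊆ ·), √(X.density s) * √(X.density s) = X.density s :=
    fun s hs => Real.mul_self_sqrt (X.density_pos s (mem_filter.1 hs).1).le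
  have e1 : ∀ A B : Finset V → ℝ, ∑ s ∈ X.top with t ⊆ s, √(X.density s) * A s *
      (√(X.density s) * B s) = X.starSum t fun s => A s * B s := fun A B =>
    sum_congr rfl fun s hs => by rw [mul_mul_mul_comm, hsq s hs]
  simp only [sq (_ * _)] at h
  simp only [e1] at h
  simpa only [sq] using h

theorem starVar_of_not_subset {t : Finset V} (h : ∀ s ∈ X.top, ¬ t ⊆ s) (F : Finset V → ℝ) :
    X.starVar t F = 0 := by
  simp [starVar, starSum_of_not_subset h]

theorem starSum_sub_sq {t : Finset V} (h : 0 < X.starWeight t) (F : Finset V → ℝ) (a : ℝ) :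
    X.starSum t (fun s => (F s - a) ^ 2) =
      X.starVar t F + X.starWeight t * (X.starSum t F / X.starWeight t - a) ^ 2 := by
  have : X.starSum t (fun s => (F s - a) ^ 2) =
      X.starSum t (fun s => F s ^ 2) - 2 * a * X.starSum t F + a ^ 2 * X.starWeight t := by
    rw [← starSum_const_mul, ← starSum_const, ← starSum_sub, ← starSum_add]
    exact starSum_congr fun s _ _ => by ring
  rw [this, starVar]
  field_simp
  ring

theorem starVar_le_starSum_sub_sq (t : Finset V) (F : Finset V → ℝ) (a : ℝ) :
    X.starVar t F ≤ X.starSum t fun s => (F s - a) ^ 2 := by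
  rcases X.starWeight_eq_zero_or_pos t with h | h
  · rw [starVar_of_not_subset h, starSum_of_not_subset h]
  · rw [starSum_sub_sq h]
    have := mul_nonneg h.le (sq_nonneg (X.starSum t F / X.starWeight t - a))
    linarith

theorem starVar_sub_const (t : Finset V) (F : Finset V → ℝ) (a : ℝ) :
    X.starVar t (fun s => F s - a) = X.starVar t F := by
  rcases X.starWeight_eq_zero_or_pos t with h | h
  · rw [starVar_of_not_subset h, starVar_of_not_subset h]
  · rw [starVar, starSum_sub_sq h, starSum_sub, starSum_const]
    field_simp
    ring

theorem starVar_nonneg (t : Finset V) (F : Finset V → ℝ) : 0 ≤ X.starVar t F := by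
  rcases X.starWeight_eq_zero_or_pos t with h | h
  · rw [starVar_of_not_subset h]
  · have := starSum_sub_sq h F (X.starSum t F / X.starWeight t)
    rw [sub_self, zero_pow two_ne_zero, mul_zero, add_zero] at this
    rw [← this]
    exact starSum_nonneg fun s _ _ => sq_nonneg _

theorem starVar_eq_zero_of_card_eq {t : Finset V} (ht : t.card = d) (F : Finset V → ℝ) :
    X.starVar t F = 0 := by
  rcases X.starWeight_eq_zero_or_pos t with h | h
  · exact starVar_of_not_subset h F
  · refine le_antisymm ?_ (starVar_nonneg t F)
    refine (starVar_le_starSum_sub_sq t F (F t)).trans_eq ?_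
    rw [starSum_congr (G := fun _ => 0) fun s hs hts => ?_, starSum_const, zero_mul]
    rw [eq_of_subset_of_card_le hts (by rw [X.card_of_mem_top s hs, ht]), sub_self, zero_pow two_ne_zero]

/-- Choosing `r ⊇ t` with `m` further vertices by picking one of these vertices first counts every
`r` exactly `m` times. -/
theorem sum_faces_insert (t : Finset V) (m : ℕ) (φ : Finset V → ℝ) :
    ∑ v ∈ X.verts \ t, ∑ r ∈ X.faces (t.card + m) with insert v t ⊆ r, φ r =
      m * ∑ r ∈ X.faces (t.card + m) with t ⊆ r, φ r := by
  have : ∑ v ∈ X.verts \ t, ∑ r ∈ X.faces (t.card + m) with insert v t ⊆ r, φ r =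
      ∑ r ∈ X.faces (t.card + m) with t ⊆ r, ∑ v ∈ r \ t, φ r := by
    refine sum_comm' fun v s => ?_
    simp only [mem_sdiff, mem_filter, insert_subset_iff]
    refine ⟨fun ⟨⟨_, h2⟩, h3, h4, h5⟩ => ⟨⟨h4, h2⟩, h3, h5⟩, fun ⟨⟨h4, h2⟩, h3, h5⟩ => ?_⟩
    obtain ⟨⟨u, hu, hsu⟩, -⟩ := mem_faces.1 h3
    exact ⟨⟨top_subset_verts hu (hsu h4), h2⟩, h3, h4, h5⟩
  rw [this, mul_sum]
  refine sum_congr rfl fun r hr => ?_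
  rw [mem_filter, mem_faces] at hr
  rw [sum_const, nsmul_eq_mul, card_sdiff_of_subset hr.2, hr.1.2, Nat.add_sub_cancel_left]

end WeightedComplex

/-! ### Spectral gaps of links and the trickling-down theorem -/

namespace WeightedComplex

variable {V : Type*} [DecidableEq V] {d : ℕ} (X : WeightedComplex V d)

/-- The vertices of the link of `t`. -/
def linkVerts (t : Finset V) : Finset V :=
  (X.verts \ t).filter fun v => insert v t ∈ X.faces (t.card + 1)

/-- The normalized adjacency operator of the graph underlying the link of `t`, written in terms of
`X`: the mean of `h` over the vertices other than `v` of the random top-level face containing `t`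
and `v`. -/
def linkAdj (t : Finset V) (h : V → ℝ) (v : V) : ℝ :=
  X.starSum (insert v t) (fun s => ∑ u ∈ s \ insert v t, h u) /
    (((d : ℝ) - t.card - 1) * X.starWeight (insert v t))

/-- The graph underlying the link of `t` is a `c`-one-sided expander. -/
def LinkGapLE (t : Finset V) (c : ℝ) : Prop :=
  SecondEigenvalueLE (X.linkVerts t) (fun v => X.starWeight (insert v t)) (X.linkAdj t) c

variable {X}

theorem mem_linkVerts {t : Finset V} {v : V} :
    v ∈ X.linkVerts t ↔ v ∉ t ∧ 0 < X.starWeight (insert v t) := by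
  rw [linkVerts, mem_filter, mem_sdiff, mem_faces_iff_starWeight_pos]
  constructor
  · rintro ⟨⟨-, h1⟩, h2, -⟩
    exact ⟨h1, h2⟩
  · rintro ⟨h1, h2⟩
    obtain ⟨s, hs, hts⟩ := exists_subset_of_starWeight_pos h2
    exact ⟨⟨top_subset_verts hs (hts (mem_insert_self v t)), h1⟩, h2, card_insert_of_notMem h1⟩

theorem mem_linkVerts_of_mem_sdiff {t s : Finset V} {v : V} (hs : s ∈ X.top) (hts : t ⊆ s)
    (hv : v ∈ s \ t) : v ∈ X.linkVerts t :=
  mem_linkVerts.2 ⟨(mem_sdiff.1 hv).2,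
    starWeight_pos hs (insert_subset (mem_sdiff.1 hv).1 hts)⟩

theorem sum_linkVerts_starSum (t : Finset V) (F : V → Finset V → ℝ) :
    ∑ v ∈ X.linkVerts t, X.starSum (insert v t) (F v) =
      X.starSum t fun s => ∑ v ∈ s \ t, F v s := by
  rw [← sum_starSum_insert]
  refine sum_subset (filter_subset _ _) fun v hv hv' => ?_
  rcases X.starWeight_eq_zero_or_pos (insert v t) with h | h
  · exact starSum_of_not_subset h _
  · exact absurd (mem_linkVerts.2 ⟨(mem_sdiff.1 hv).2, h⟩) hv'

theorem sum_linkVerts_starWeight_mul (t : Finset V) (h : V → ℝ) :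
    ∑ v ∈ X.linkVerts t, X.starWeight (insert v t) * h v = X.starSum t fun s => ∑ v ∈ s \ t, h v := by
  rw [← sum_linkVerts_starSum t fun v _ => h v]
  simp only [starSum_const, mul_comm]

theorem sum_sdiff_insert {t s : Finset V} {v : V} (hv : v ∈ s \ t) (h : V → ℝ) :
    ∑ u ∈ s \ insert v t, h u = ∑ u ∈ s \ t, h u - h v := by
  rw [sdiff_insert, ← sum_erase_add _ _ hv]
  ring

theorem starWeight_mul_linkAdj {t : Finset V} (ht : t.card + 2 ≤ d) {v : V}
    (hv : v ∈ X.linkVerts t) (h : V → ℝ) :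
    ((d : ℝ) - t.card - 1) * (X.starWeight (insert v t) * X.linkAdj t h v) =
      X.starSum (insert v t) fun s => ∑ u ∈ s \ insert v t, h u := by
  have h1 := (mem_linkVerts.1 hv).2.ne'
  have h2 : (t.card : ℝ) + 2 ≤ d := by exact_mod_cast ht
  have h3 : (d : ℝ) - t.card - 1 ≠ 0 := by linarith
  rw [linkAdj]
  field_simp

theorem sum_mul_linkAdj {t : Finset V} (ht : t.card + 2 ≤ d) (g h : V → ℝ) :
    ((d : ℝ) - t.card - 1) *
        ∑ v ∈ X.linkVerts t, X.starWeight (insert v t) * (g v * X.linkAdj t h v) =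
      X.starSum t fun s => (∑ v ∈ s \ t, g v) * (∑ v ∈ s \ t, h v) - ∑ v ∈ s \ t, g v * h v := by
  have h1 : ((d : ℝ) - t.card - 1) *
        ∑ v ∈ X.linkVerts t, X.starWeight (insert v t) * (g v * X.linkAdj t h v) =
      ∑ v ∈ X.linkVerts t, X.starSum (insert v t) fun s => g v * ∑ u ∈ s \ insert v t, h u := by
    rw [mul_sum]
    refine sum_congr rfl fun v hv => ?_
    rw [starSum_const_mul, ← starWeight_mul_linkAdj ht hv]
    ring
  rw [h1, sum_linkVerts_starSum]
  refine starSum_congr fun s _ _ => ?_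
  rw [sum_mul, ← sum_sub_distrib]
  refine sum_congr rfl fun v hv => ?_
  rw [sum_sdiff_insert hv]
  ring

/-- An expanding link, as a bound on the second moment of `∑ h` over the vertices of a random
top-level face. -/
theorem LinkGapLE.starSum_sq_le {t : Finset V} {c : ℝ} (hgap : X.LinkGapLE t c)
    (ht : t.card + 2 ≤ d) (h : V → ℝ) (h0 : X.starSum t (fun s => ∑ v ∈ s \ t, h v) = 0) :
    X.starSum t (fun s => (∑ v ∈ s \ t, h v) ^ 2) ≤
      (1 + ((d : ℝ) - t.card - 1) * c) * X.starSum t fun s => ∑ v ∈ s \ t, h v ^ 2 := by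
  have h2 : (t.card : ℝ) + 2 ≤ d := by exact_mod_cast ht
  have hpos : 0 < (d : ℝ) - t.card - 1 := by linarith
  have key := SecondEigenvalueLE.sum_mul_le hgap (fun v hv => (mem_linkVerts.1 hv).2)
    (fun f g hfg v hv => by
      rw [linkAdj, linkAdj, starSum_congr fun s hs hts => sum_congr rfl fun u hu => ?_]
      refine hfg u (mem_linkVerts_of_mem_sdiff hs ((subset_insert v t).trans hts) ?_)
      exact sdiff_subset_sdiff subset_rfl (subset_insert v t) hu)
    (fun f g v hv => by
      simp only [linkAdj, Pi.add_apply, sum_add_distrib, starSum_add, add_div])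
    (fun a f v hv => by
      simp only [linkAdj, Pi.smul_apply, smul_eq_mul, ← mul_sum, starSum_const_mul, mul_div_assoc])
    (fun f g => by
      refine mul_left_cancel₀ hpos.ne' ?_
      rw [sum_mul_linkAdj ht]
      simp only [mul_comm (X.linkAdj t f _)]
      rw [sum_mul_linkAdj ht]
      simp only [mul_comm (f _), mul_comm (∑ v ∈ _, f v)])
    (fun v hv => by
      have hv' := mem_linkVerts.1 hv
      rw [linkAdj, starSum_congr (G := fun _ => (d : ℝ) - t.card - 1) fun s hs hts => ?_,
        starSum_const]
      · exact div_self (mul_pos hpos hv'.2).ne'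
      · rw [sum_const, nsmul_eq_mul, card_sdiff_of_mem_top hs hts, card_insert_of_notMem hv'.1]
        push_cast
        ring)
    h (by rw [sum_linkVerts_starWeight_mul, h0])
  rw [sum_linkVerts_starWeight_mul t fun v => h v ^ 2] at key
  have h3 := mul_le_mul_of_nonneg_left key hpos.le
  rw [sum_mul_linkAdj ht, starSum_sub] at h3
  simp only [← sq] at h3
  linarith

/-- The graph underlying the link of `t` is connected, as a statement about functions on its
vertices: those that agree at the ends of every edge are constant. -/
def LinkConnected (X : WeightedComplex V d) (t : Finset V) : Prop :=
  ∀ h : V → ℝ, (∀ s ∈ X.top, t ⊆ s → ∀ u ∈ s \ t, ∀ v ∈ s \ t, h u = h v) →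
    ∀ u ∈ X.linkVerts t, ∀ v ∈ X.linkVerts t, h u = h v

/-- One is a simple eigenvalue of the adjacency operator of a connected graph, and no eigenvalue is
larger. -/
theorem eigenvalue_lt_one {t : Finset V} (ht : t.card + 2 ≤ d) (hconn : X.LinkConnected t)
    {η : ℝ} {h : V → ℝ} (h0 : ∑ v ∈ X.linkVerts t, X.starWeight (insert v t) * h v = 0)
    (hne : ∃ v ∈ X.linkVerts t, h v ≠ 0)
    (heig : ∀ v ∈ X.linkVerts t, X.linkAdj t h v = η * h v) : η < 1 := by
  by_contra! hη
  have h2 : (t.card : ℝ) + 2 ≤ d := by exact_mod_cast ht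
  set N := X.starSum t fun s => ∑ v ∈ s \ t, h v ^ 2 with hN
  have hN0 : 0 ≤ N := starSum_nonneg fun s _ _ => sum_nonneg fun v _ => sq_nonneg _
  have hQ := sum_mul_linkAdj (X := X) ht h h
  have hQ' : ∑ v ∈ X.linkVerts t, X.starWeight (insert v t) * (h v * X.linkAdj t h v) = η * N := by
    rw [hN, ← sum_linkVerts_starWeight_mul, mul_sum]
    exact sum_congr rfl fun v hv => by rw [heig v hv]; ring
  -- the Dirichlet form of `h` is `2 (n - 1) (1 - η) N` for `n = d - |t|`
  have hD : X.starSum t (fun s => ∑ u ∈ s \ t, ∑ v ∈ s \ t, (h u - h v) ^ 2) ≤ 0 := by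
    have h3 : X.starSum t (fun s => ∑ u ∈ s \ t, ∑ v ∈ s \ t, (h u - h v) ^ 2) =
        2 * ((d : ℝ) - t.card - 1) * N - 2 * X.starSum t fun s =>
          (∑ v ∈ s \ t, h v) * (∑ v ∈ s \ t, h v) - ∑ v ∈ s \ t, h v * h v := by
      rw [hN, ← starSum_const_mul, ← starSum_const_mul, ← starSum_sub]
      refine starSum_congr fun s hs hts => ?_
      simp only [sub_sq, sum_add_distrib, sum_sub_distrib, sum_const, nsmul_eq_mul, ← mul_sum,
        ← sum_mul, card_sdiff_of_mem_top hs hts]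
      simp only [sq]
      ring
    rw [h3, ← hQ, hQ']
    nlinarith [mul_nonneg (mul_nonneg (by linarith : (0 : ℝ) ≤ d - t.card - 1) hN0)
      (sub_nonneg.2 hη)]
  have hloc : ∀ s ∈ X.top, t ⊆ s → ∀ u ∈ s \ t, ∀ v ∈ s \ t, h u = h v := by
    intro s hs hts u hu v hv
    have hnn : ∀ s ∈ X.top.filter (t ⊆ ·),
        0 ≤ X.density s * ∑ u ∈ s \ t, ∑ v ∈ s \ t, (h u - h v) ^ 2 := fun s hs =>
      mul_nonneg (X.density_pos s (mem_filter.1 hs).1).le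
        (sum_nonneg fun u _ => sum_nonneg fun v _ => sq_nonneg _)
    have h4 := (sum_eq_zero_iff_of_nonneg hnn).1 (le_antisymm hD (sum_nonneg hnn)) s
      (mem_filter.2 ⟨hs, hts⟩)
    have h5 := (mul_eq_zero.1 h4).resolve_left (X.density_pos s hs).ne'
    have h6 := (sum_eq_zero_iff_of_nonneg fun u _ => sum_nonneg fun v _ => sq_nonneg _).1 h5 u hu
    have h7 := (sum_eq_zero_iff_of_nonneg fun v _ => sq_nonneg _).1 h6 v hv
    exact sub_eq_zero.1 (pow_eq_zero_iff two_ne_zero |>.1 h7)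
  obtain ⟨u, hu, hune⟩ := hne
  have hc := hconn h hloc
  rw [sum_congr rfl fun v hv => by rw [hc v hv u hu], ← sum_mul] at h0
  refine (mul_eq_zero.1 h0).elim (fun h8 => ?_) hune
  exact (sum_pos (fun v hv => (mem_linkVerts.1 hv).2) ⟨u, hu⟩).ne' h8

/-- Oppenheim's trickling-down theorem. For an eigenfunction `h` of eigenvalue `η` on the link of
`t`, the mean of `h` on the link of `insert v t` is `η h(v)`; applying the expansion of these links
to `h - η h(v)` and averaging over `v` gives `η - η² ≤ μ (1 - η²)`, where `η < 1` by
connectivity. -/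
theorem LinkGapLE.of_insert {t : Finset V} (ht : t.card + 3 ≤ d) (hconn : X.LinkConnected t)
    {μ : ℝ} (hμ : μ < 1) (hlink : ∀ v ∈ X.linkVerts t, X.LinkGapLE (insert v t) μ) :
    X.LinkGapLE t (μ / (1 - μ)) := by
  intro η h h0 hne heig
  have hη : η < 1 := eigenvalue_lt_one (by omega) hconn h0 hne heig
  have hn : (t.card : ℝ) + 3 ≤ d := by exact_mod_cast ht
  set n : ℝ := (d : ℝ) - t.card with hn'
  set N := X.starSum t fun s => ∑ v ∈ s \ t, h v ^ 2 with hN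
  have hWN : ∑ v ∈ X.linkVerts t, X.starWeight (insert v t) * h v ^ 2 = N :=
    sum_linkVerts_starWeight_mul t fun v => h v ^ 2
  have hNpos : 0 < N := by
    obtain ⟨v, hv, hvne⟩ := hne
    rw [← hWN]
    refine sum_pos' (fun u hu => mul_nonneg (starWeight_nonneg _) (sq_nonneg _)) ⟨v, hv, ?_⟩
    exact mul_pos (mem_linkVerts.1 hv).2 (by positivity)
  have hQ : X.starSum t (fun s => (∑ v ∈ s \ t, h v) ^ 2) = (1 + (n - 1) * η) * N := by
    have h1 := sum_mul_linkAdj (X := X) (t := t) (by omega) h h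
    have h2 : ∑ v ∈ X.linkVerts t, X.starWeight (insert v t) * (h v * X.linkAdj t h v) = η * N := by
      rw [← hWN, mul_sum]
      exact sum_congr rfl fun v hv => by rw [heig v hv]; ring
    rw [h2, starSum_sub] at h1
    simp only [← sq] at h1
    rw [← hN] at h1
    linarith
  -- the expansion of the link of `insert v t`, applied to `h` minus its mean there
  have hv : ∀ v ∈ X.linkVerts t,
      X.starSum (insert v t) (fun s => (∑ u ∈ s \ insert v t, h u) ^ 2) -
          (n - 1) ^ 2 * η ^ 2 * (X.starWeight (insert v t) * h v ^ 2) ≤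
        (1 + (n - 2) * μ) * (X.starSum (insert v t) (fun s => ∑ u ∈ s \ insert v t, h u ^ 2) -
          (n - 1) * η ^ 2 * (X.starWeight (insert v t) * h v ^ 2)) := by
    intro v hv
    have hvt := (mem_linkVerts.1 hv).1
    have hcard : (insert v t).card = t.card + 1 := card_insert_of_notMem hvt
    have hcs : ∀ s ∈ X.top, insert v t ⊆ s → ((s \ insert v t).card : ℝ) = n - 1 :=
      fun s hs hts => by
        rw [card_sdiff_of_mem_top hs hts, hcard, hn']
        push_cast
        ring
    have hS : X.starSum (insert v t) (fun s => ∑ u ∈ s \ insert v t, h u) =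
        (n - 1) * (X.starWeight (insert v t) * (η * h v)) := by
      rw [← starWeight_mul_linkAdj (by omega) hv, heig v hv]
    have e1 : X.starSum (insert v t) (fun s => ∑ u ∈ s \ insert v t, (h u - η * h v)) = 0 := by
      rw [starSum_congr (G := fun s => ∑ u ∈ s \ insert v t, h u - (n - 1) * (η * h v))
        fun s hs hts => by rw [sum_sub_distrib, sum_const, nsmul_eq_mul, hcs s hs hts],
        starSum_sub, starSum_const, hS]
      ring
    have e2 : X.starSum (insert v t) (fun s => (∑ u ∈ s \ insert v t, (h u - η * h v)) ^ 2) =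
        X.starSum (insert v t) (fun s => (∑ u ∈ s \ insert v t, h u) ^ 2) -
          (n - 1) ^ 2 * η ^ 2 * (X.starWeight (insert v t) * h v ^ 2) := by
      rw [starSum_congr (G := fun s => (∑ u ∈ s \ insert v t, h u) ^ 2 -
          2 * ((n - 1) * (η * h v)) * ∑ u ∈ s \ insert v t, h u + ((n - 1) * (η * h v)) ^ 2)
        fun s hs hts => by
          rw [sum_sub_distrib, sum_const, nsmul_eq_mul, hcs s hs hts]
          ring, starSum_add, starSum_sub, starSum_const, starSum_const_mul, hS]
      ring
    have e3 : X.starSum (insert v t) (fun s => ∑ u ∈ s \ insert v t, (h u - η * h v) ^ 2) =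
        X.starSum (insert v t) (fun s => ∑ u ∈ s \ insert v t, h u ^ 2) -
          (n - 1) * η ^ 2 * (X.starWeight (insert v t) * h v ^ 2) := by
      rw [starSum_congr (G := fun s => ∑ u ∈ s \ insert v t, h u ^ 2 -
          2 * (η * h v) * ∑ u ∈ s \ insert v t, h u + (n - 1) * (η * h v) ^ 2)
        fun s hs hts => by
          simp only [sub_sq, sum_add_distrib, sum_sub_distrib, sum_const, nsmul_eq_mul,
            hcs s hs hts, ← mul_sum, ← sum_mul]
          ring, starSum_add, starSum_sub, starSum_const, starSum_const_mul, hS]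
      ring
    have key := (hlink v hv).starSum_sq_le (by omega) (fun u => h u - η * h v) e1
    rw [e2, e3, hcard] at key
    convert key using 2
    push_cast
    ring
  have hsum := sum_le_sum hv
  rw [← mul_sum, sum_sub_distrib, sum_sub_distrib, ← mul_sum, ← mul_sum, hWN,
    sum_linkVerts_starSum, sum_linkVerts_starSum] at hsum
  have f1 : X.starSum t (fun s => ∑ v ∈ s \ t, (∑ u ∈ s \ insert v t, h u) ^ 2) =
      (n - 2) * ((1 + (n - 1) * η) * N) + N := by
    rw [← hQ, hN, ← starSum_const_mul, ← starSum_add]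
    refine starSum_congr fun s hs hts => ?_
    rw [sum_congr rfl fun v hv => by rw [sum_sdiff_insert hv]]
    simp only [sub_sq, sum_add_distrib, sum_sub_distrib, sum_const, nsmul_eq_mul, ← mul_sum,
      card_sdiff_of_mem_top hs hts]
    rw [← hn']
    ring
  have f2 : X.starSum t (fun s => ∑ v ∈ s \ t, ∑ u ∈ s \ insert v t, h u ^ 2) = (n - 1) * N := by
    rw [hN, ← starSum_const_mul]
    refine starSum_congr fun s hs hts => ?_
    rw [sum_congr rfl fun v hv => by rw [sum_sdiff_insert hv fun u => h u ^ 2], sum_sub_distrib,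
      sum_const, nsmul_eq_mul, card_sdiff_of_mem_top hs hts]
    ring
  rw [f1, f2] at hsum
  have h3 : (n - 1) * (n - 2) * N * ((1 - η) * (η - μ * (1 + η))) ≤ 0 := by linarith
  have h4 : 0 < (n - 1) * (n - 2) * N :=
    mul_pos (mul_pos (by linarith) (by linarith)) hNpos
  have h5 : η - μ * (1 + η) ≤ 0 := by
    by_contra! hc
    exact (mul_pos h4 (mul_pos (by linarith) hc)).not_ge h3
  rw [le_div_iff₀ (by linarith)]
  linarith

end WeightedComplex

/-! ### Trickling-down complexes: all links expand -/

namespace WeightedComplex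

variable {V : Type*} [DecidableEq V] {d : ℕ} {X : WeightedComplex V d}

theorem mem_link_top {k : ℕ} {s : Finset V} (hs : s ∈ X.faces k) {u : Finset V} :
    u ∈ (X.link s hs).top ↔ ∃ t ∈ X.top, s ⊆ t ∧ t \ s = u := by
  simp only [link, mem_image, mem_filter, and_assoc]

theorem mem_link_verts {k : ℕ} {s : Finset V} (hs : s ∈ X.faces k) {v : V} :
    v ∈ (X.link s hs).verts ↔ v ∈ X.linkVerts s := by
  simp only [verts, mem_biUnion, mem_link_top, id]
  constructor
  · rintro ⟨_, ⟨t, ht, hst, rfl⟩, hv⟩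
    exact mem_linkVerts_of_mem_sdiff ht hst hv
  · intro hv
    obtain ⟨h1, h2⟩ := mem_linkVerts.1 hv
    obtain ⟨t, ht, hvt⟩ := exists_subset_of_starWeight_pos h2
    exact ⟨_, ⟨t, ht, (subset_insert v s).trans hvt, rfl⟩,
      mem_sdiff.2 ⟨hvt (mem_insert_self v s), h1⟩⟩

theorem link_verts {k : ℕ} {s : Finset V} (hs : s ∈ X.faces k) :
    (X.link s hs).verts = X.linkVerts s :=
  ext fun _ => mem_link_verts hs

theorem link_starWeight {k : ℕ} {s : Finset V} (hs : s ∈ X.faces k) {u : Finset V}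
    (hu : Disjoint u s) :
    (X.link s hs).starWeight u = X.starWeight (u ∪ s) / X.starWeight s := by
  have h1 : (X.link s hs).top.filter (u ⊆ ·) =
      (X.top.filter (u ∪ s ⊆ ·)).image fun t => t \ s := by
    ext w
    simp only [mem_filter, mem_link_top, mem_image, union_subset_iff]
    constructor
    · rintro ⟨⟨t, ht, hst, rfl⟩, huw⟩
      exact ⟨t, ⟨ht, huw.trans sdiff_subset, hst⟩, rfl⟩
    · rintro ⟨t, ⟨ht, hut, hst⟩, rfl⟩
      exact ⟨⟨t, ht, hst, rfl⟩, subset_sdiff.2 ⟨hut, hu⟩⟩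
  have h2 : ∀ t ∈ X.top.filter (u ∪ s ⊆ ·), t \ s ∪ s = t := fun t ht =>
    sdiff_union_of_subset (union_subset_iff.1 (mem_filter.1 ht).2).2
  rw [starWeight, h1, sum_image fun a ha b hb hab => by
    rw [← h2 a ha, ← h2 b hb]; exact congrArg (· ∪ s) hab]
  rw [starWeight, sum_div]
  refine sum_congr rfl fun t ht => ?_
  change X.density (t \ s ∪ s) / (X.prob s * (d.choose s.card : ℝ)) = _
  rw [h2 t ht, X.prob_mul_choose hs, starWeight]

theorem link_edgeProb {k : ℕ} {s : Finset V} (hs : s ∈ X.faces k) {u v : V}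
    (hu : u ∈ X.linkVerts s) (hv : v ∈ X.linkVerts s) :
    (X.link s hs).edgeProb v u = (X.starWeight s * ((d - k).choose 2 : ℕ))⁻¹ *
      if u = v then 0 else X.starWeight (insert u (insert v s)) := by
  rcases eq_or_ne u v with rfl | huv
  · rw [edgeProb, if_neg, if_pos rfl, mul_zero]
    simp [mem_faces]
  · have hcard : ({v, u} : Finset V).card = 2 := card_pair huv.symm
    have hdisj : Disjoint ({v, u} : Finset V) s := by
      rw [disjoint_insert_left, disjoint_singleton_left]
      exact ⟨(mem_linkVerts.1 hv).1, (mem_linkVerts.1 hu).1⟩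
    have hw := link_starWeight hs hdisj
    rw [show ({v, u} : Finset V) ∪ s = insert u (insert v s) by
      rw [insert_union, singleton_union, insert_comm]] at hw
    rw [if_neg huv]
    have h1 : (X.link s hs).prob {v, u} =
        (X.starWeight s * ((d - k).choose 2 : ℕ))⁻¹ * X.starWeight (insert u (insert v s)) := by
      rw [prob, hcard]
      change (X.link s hs).starWeight {v, u} / _ = _
      rw [hw]
      field_simp
    rw [edgeProb]
    split_ifs with hmem
    · exact h1
    · rw [← h1, prob]
      rcases (X.link s hs).starWeight_eq_zero_or_pos {v, u} with h0 | h0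
      · rw [filter_false_of_mem h0, sum_empty, zero_div]
      · exact absurd (mem_faces_iff_starWeight_pos.2 ⟨h0, hcard⟩) hmem

theorem sum_link_edgeProb_mul {k : ℕ} {s : Finset V} (hs : s ∈ X.faces k) {v : V}
    (hv : v ∈ X.linkVerts s) (h : V → ℝ) :
    ∑ u ∈ (X.link s hs).verts, (X.link s hs).edgeProb v u * h u =
      (X.starWeight s * ((d - k).choose 2 : ℕ))⁻¹ *
        X.starSum (insert v s) fun t => ∑ u ∈ t \ insert v s, h u := by
  rw [link_verts, ← sum_linkVerts_starWeight_mul, mul_sum]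
  symm
  refine sum_subset_zero_on_sdiff (fun u hu => ?_) (fun u hu => ?_) fun u hu => ?_
  · obtain ⟨h1, h2⟩ := mem_linkVerts.1 hu
    rw [mem_insert, not_or] at h1
    obtain ⟨t, ht, hut⟩ := exists_subset_of_starWeight_pos h2
    exact mem_linkVerts.2 ⟨h1.2, starWeight_pos ht
      ((insert_subset_insert u (subset_insert v s)).trans hut)⟩
  · rw [mem_sdiff] at hu
    rw [link_edgeProb hs hu.1 hv]
    split_ifs with huv
    · rw [mul_zero, zero_mul]
    · rcases X.starWeight_eq_zero_or_pos (insert u (insert v s)) with h0 | h0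
      · rw [starWeight_of_not_subset h0, mul_zero, zero_mul]
      · refine absurd (mem_linkVerts.2 ⟨?_, h0⟩) hu.2
        rw [mem_insert, not_or]
        exact ⟨huv, (mem_linkVerts.1 hu.1).1⟩
  · obtain ⟨h1, h2⟩ := mem_linkVerts.1 hu
    rw [mem_insert, not_or] at h1
    obtain ⟨t, ht, hut⟩ := exists_subset_of_starWeight_pos h2
    have hus : u ∈ X.linkVerts s := mem_linkVerts.2 ⟨h1.2, starWeight_pos ht
      ((insert_subset_insert u (subset_insert v s)).trans hut)⟩
    rw [link_edgeProb hs hus hv, if_neg h1.1, mul_assoc]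

theorem sum_link_edgeProb {k : ℕ} {s : Finset V} (hs : s ∈ X.faces k) {v : V}
    (hv : v ∈ X.linkVerts s) :
    ∑ u ∈ (X.link s hs).verts, (X.link s hs).edgeProb v u =
      (X.starWeight s * ((d - k).choose 2 : ℕ))⁻¹ *
        (((d : ℝ) - k - 1) * X.starWeight (insert v s)) := by
  have h := sum_link_edgeProb_mul hs hv fun _ => 1
  simp only [mul_one] at h
  rw [h, ← starSum_const]
  congr 1
  refine starSum_congr fun t ht hvt => ?_
  rw [sum_const, nsmul_eq_mul, card_sdiff_of_mem_top ht hvt,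
    card_insert_of_notMem (mem_linkVerts.1 hv).1, (mem_faces.1 hs).2]
  push_cast
  ring

theorem IsOneSidedExpander.linkGapLE {k : ℕ} {s : Finset V} {hs : s ∈ X.faces k} {c : ℝ}
    (h : (X.link s hs).IsOneSidedExpander c) (hk : k + 2 ≤ d) : X.LinkGapLE s c := by
  have hk' : (k : ℝ) + 2 ≤ d := by exact_mod_cast hk
  have hcard := (mem_faces.1 hs).2
  have hκ : (X.starWeight s * ((d - k).choose 2 : ℕ))⁻¹ ≠ 0 := by
    refine inv_ne_zero (mul_ne_zero (mem_faces_iff_starWeight_pos.1 hs).1.ne' ?_)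
    exact_mod_cast (Nat.choose_pos (by omega)).ne'
  intro η f h0 hne heig
  refine h η f ?_ ?_ fun v hv => ?_
  · rw [link_verts]
    have : ∀ v ∈ X.linkVerts s, (X.link s hs).vertexProb v * f v =
        (1 / 2 * ((X.starWeight s * ((d - k).choose 2 : ℕ))⁻¹ * ((d : ℝ) - k - 1))) *
          (X.starWeight (insert v s) * f v) := fun v hv => by
      rw [vertexProb, sum_link_edgeProb hs hv]
      ring
    rw [sum_congr rfl this, ← mul_sum, h0, mul_zero]
  · rwa [link_verts]
  · rw [link_verts] at hv
    rw [← heig v hv, adjOp, linkAdj, hcard]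
    simp only [div_mul_eq_mul_div]
    rw [← sum_div, sum_link_edgeProb_mul hs hv, sum_link_edgeProb hs hv,
      mul_div_mul_left _ _ hκ]

theorem linkConnected_of_connected {k : ℕ} {s : Finset V} {hs : s ∈ X.faces k}
    (h : (X.link s hs).graph.Connected) : X.LinkConnected s := by
  intro f hf u hu v hv
  rw [← mem_link_verts hs] at hu hv
  obtain ⟨w⟩ := h.preconnected ⟨u, hu⟩ ⟨v, hv⟩
  have key : ∀ a b : {v : V // v ∈ (X.link s hs).verts}, (X.link s hs).graph.Walk a b →
      f a = f b := by
    intro a b w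
    induction w with
    | nil => rfl
    | cons hadj _ ih =>
      rw [← ih]
      obtain ⟨⟨r, hr, hsub⟩, -⟩ := mem_faces.1 hadj.2
      obtain ⟨t, ht, hst, rfl⟩ := (mem_link_top hs).1 hr
      exact hf t ht hst _ (hsub (mem_insert_self _ _)) _
        (hsub (mem_insert_of_mem (mem_singleton_self _)))
  exact key _ _ w

theorem sub_mul_pos_of_lt_one {n lam x : ℝ} (hn : 0 < n) (hlam : lam < 1) (hx0 : 0 ≤ x)
    (hxn : x ≤ n) : 0 < n - x * lam := by
  rcases le_total lam 0 with h | h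
  · nlinarith [mul_nonneg hx0 (neg_nonneg.2 h)]
  · nlinarith [mul_le_mul_of_nonneg_right hxn h]

/-- The expansion of the links of every codimension `i + 2` of a trickling-down complex. -/
theorem IsTricklingDown.linkGapLE {lam : ℝ} (hlam : lam < 1) (h : X.IsTricklingDown lam) (i : ℕ) :
    ∀ s : Finset V, 0 < X.starWeight s → s.card + i + 2 = d →
      X.LinkGapLE s (lam / ((d : ℝ) - 1 - i * lam)) := by
  induction i with
  | zero =>
    intro s hs hd
    have hs' : s ∈ X.faces s.card := mem_faces_iff_starWeight_pos.2 ⟨hs, rfl⟩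
    simpa using (h.2 _ s hs' hd).linkGapLE hd.le
  | succ i ih =>
    intro s hs hd
    have hs' : s ∈ X.faces s.card := mem_faces_iff_starWeight_pos.2 ⟨hs, rfl⟩
    have hd' : (s.card : ℝ) + (i + 1) + 2 = d := by exact_mod_cast hd
    have hi : (0 : ℝ) ≤ i := i.cast_nonneg
    have hc : (0 : ℝ) ≤ s.card := s.card.cast_nonneg
    have h1 := sub_mul_pos_of_lt_one (n := d - 1) (x := i) (by linarith) hlam hi (by linarith)
    have h2 := sub_mul_pos_of_lt_one (n := d - 1) (x := i + 1) (by linarith) hlam (by linarith)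
      (by linarith)
    have key := LinkGapLE.of_insert (μ := lam / ((d : ℝ) - 1 - i * lam)) (by omega)
      (linkConnected_of_connected (h.1 _ s hs' (by omega)))
      (by rw [div_lt_one h1]; linarith) fun v hv => by
        obtain ⟨hv1, hv2⟩ := mem_linkVerts.1 hv
        exact ih (insert v s) hv2 (by rw [card_insert_of_notMem hv1]; omega)
    convert key using 1
    push_cast
    rw [one_sub_div h1.ne', div_div_div_cancel_right₀ h1.ne']
    congr 1
    ring

/-! ### The Poincaré inequality of the down-up walk -/

/-- The Poincaré inequality of the down-up walk on the top-level faces, with constant `C`: the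
variance is at most `C` times the sum of the variances left after conditioning on all vertices of
the face but one. For `d = 0` the truncated `d - 1` leaves the empty face, and both sides vanish. -/
def HasPoincare (X : WeightedComplex V d) (C : ℝ) : Prop :=
  ∀ F : Finset V → ℝ, X.starVar ∅ F ≤ C * ∑ r ∈ X.faces (d - 1), X.starVar r F

/-- The second eigenvalue of the link of `t` is at least that of the complete graph on the
`d - |t|` vertices of a single top-level face. -/
theorem LinkGapLE.one_add_nonneg {t : Finset V} {c : ℝ} (hgap : X.LinkGapLE t c)
    (hpos : 0 < X.starWeight t) (ht : t.card + 2 ≤ d) :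
    0 ≤ 1 + ((d : ℝ) - t.card - 1) * c := by
  obtain ⟨s, hs, hts⟩ := exists_subset_of_starWeight_pos hpos
  have hcard : 1 < (s \ t).card := by
    rw [card_sdiff_of_subset hts, X.card_of_mem_top s hs]
    omega
  obtain ⟨a, ha, b, hb, hab⟩ := one_lt_card.1 hcard
  have ha' := mem_linkVerts_of_mem_sdiff hs hts ha
  have hb' := mem_linkVerts_of_mem_sdiff hs hts hb
  have hwa := (mem_linkVerts.1 ha').2
  have hwb := (mem_linkVerts.1 hb').2
  -- a nonzero function of mean zero, supported on two vertices
  let h : V → ℝ := fun v => if v = a then (X.starWeight (insert a t))⁻¹ else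
    if v = b then -(X.starWeight (insert b t))⁻¹ else 0
  have h0 : X.starSum t (fun s => ∑ v ∈ s \ t, h v) = 0 := by
    rw [← sum_linkVerts_starWeight_mul, ← add_sum_erase _ _ ha',
      sum_eq_single_of_mem b (mem_erase.2 ⟨hab.symm, hb'⟩) fun v hv hvb => by
        simp [h, hvb, (mem_erase.1 hv).1]]
    simp [h, hab.symm, hwa.ne', hwb.ne']
  have hN : 0 < X.starSum t fun s => ∑ v ∈ s \ t, h v ^ 2 := by
    rw [← sum_linkVerts_starWeight_mul]
    refine sum_pos' (fun v _ => mul_nonneg (starWeight_nonneg _) (sq_nonneg _)) ⟨a, ha', ?_⟩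
    simp only [h, if_true]
    positivity
  have key := hgap.starSum_sq_le ht h h0
  have h1 : 0 ≤ X.starSum t (fun s => (∑ v ∈ s \ t, h v) ^ 2) :=
    starSum_nonneg fun s _ _ => sq_nonneg _
  by_contra! hc
  exact (mul_neg_of_neg_of_pos hc hN).not_ge (h1.trans key)

/-- One step from the links of the vertices to the complex. The variance of `F` exceeds the average
of its variances given one vertex `v` by the variance of the conditional means `Φ v`. The latter is
the correlation of `F` with the sum of `Φ` over the vertices of the face, so Cauchy-Schwarz and the
expansion of the link bound it by a fraction of the variance of `F`. -/
theorem LinkGapLE.mul_starVar_le {t : Finset V} {c : ℝ} (hgap : X.LinkGapLE t c)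
    (hpos : 0 < X.starWeight t) (ht : t.card + 2 ≤ d) (F : Finset V → ℝ) :
    ((d : ℝ) - t.card - 1) * (1 - c) * X.starVar t F ≤
      ∑ v ∈ X.linkVerts t, X.starVar (insert v t) F := by
  set n : ℝ := (d : ℝ) - t.card with hn
  set m := X.starSum t F / X.starWeight t with hm
  rw [← starVar_sub_const t F m, sum_congr rfl fun v _ => (starVar_sub_const _ F m).symm]
  set G : Finset V → ℝ := fun s => F s - m with hG
  have hG0 : X.starSum t G = 0 := by
    rw [hG, starSum_sub, starSum_const, hm]
    field_simp
    ring
  have hV : X.starVar t G = X.starSum t fun s => G s ^ 2 := by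
    rw [starVar, hG0]
    simp
  set Φ : V → ℝ := fun v => X.starSum (insert v t) G / X.starWeight (insert v t) with hΦ
  have hWΦ : ∀ v ∈ X.linkVerts t, X.starWeight (insert v t) * Φ v = X.starSum (insert v t) G :=
    fun v hv => by rw [hΦ]; exact mul_div_cancel₀ _ (mem_linkVerts.1 hv).2.ne'
  set N := X.starSum t fun s => ∑ v ∈ s \ t, Φ v ^ 2 with hN
  have hN0 : 0 ≤ N := starSum_nonneg fun s _ _ => sum_nonneg fun v _ => sq_nonneg _
  have hNeq : N = X.starSum t fun s => G s * ∑ v ∈ s \ t, Φ v := by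
    simp only [mul_sum]
    rw [← sum_linkVerts_starSum, hN, ← sum_linkVerts_starWeight_mul]
    refine sum_congr rfl fun v hv => ?_
    simp only [mul_comm (G _)]
    rw [starSum_const_mul, ← hWΦ v hv]
    ring
  have hΦ0 : X.starSum t (fun s => ∑ v ∈ s \ t, Φ v) = 0 := by
    rw [← sum_linkVerts_starWeight_mul, sum_congr rfl hWΦ, sum_linkVerts_starSum t fun _ => G,
      starSum_congr (G := fun s => n * G s) fun s hs hts => by
        rw [sum_const, nsmul_eq_mul, card_sdiff_of_mem_top hs hts], starSum_const_mul, hG0,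
      mul_zero]
  have hsum : ∑ v ∈ X.linkVerts t, X.starVar (insert v t) G = n * X.starVar t G - N := by
    simp only [starVar]
    rw [sum_sub_distrib, sum_linkVerts_starSum t fun _ s => G s ^ 2,
      starSum_congr (G := fun s => n * G s ^ 2) fun s hs hts => by
        rw [sum_const, nsmul_eq_mul, card_sdiff_of_mem_top hs hts], starSum_const_mul, hG0, hN,
      ← sum_linkVerts_starWeight_mul]
    congr 1
    · simp
    · refine sum_congr rfl fun v hv => ?_
      have := (mem_linkVerts.1 hv).2.ne'
      rw [hΦ]
      field_simp
  have hNle : N ≤ (1 + (n - 1) * c) * X.starVar t G := by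
    rcases hN0.eq_or_lt with h0 | h0
    · rw [← h0]
      exact mul_nonneg (hgap.one_add_nonneg hpos ht) (starVar_nonneg t G)
    · have h1 := starSum_mul_sq_le (X := X) t G fun s => ∑ v ∈ s \ t, Φ v
      rw [← hNeq, ← hV] at h1
      have h2 := mul_le_mul_of_nonneg_left (hgap.starSum_sq_le ht Φ hΦ0) (starVar_nonneg (X := X) t G)
      refine le_of_mul_le_mul_right ?_ h0
      rw [← sq]
      linarith
  rw [hsum]
  linarith

/-- Local-to-global: the Poincaré inequality on the star of a face of codimension `m + 1`. The
product of the factors `1 / (1 - c)` over the codimensions telescopes. -/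
theorem IsTricklingDown.starVar_le {lam : ℝ} (hlam : lam < 1) (h : X.IsTricklingDown lam)
    (hd : 2 ≤ d) (F : Finset V → ℝ) (m : ℕ) :
    ∀ t : Finset V, t.card + m + 1 = d →
      X.starVar t F ≤ ((d : ℝ) - 1) / ((d : ℝ) - 1 - m * lam) *
        ∑ r ∈ X.faces (t.card + m) with t ⊆ r, X.starVar r F := by
  have hd1 : (0 : ℝ) < (d : ℝ) - 1 := by
    have : (2 : ℝ) ≤ d := by exact_mod_cast hd
    linarith
  induction m with
  | zero =>
    intro t htd
    rcases X.starWeight_eq_zero_or_pos t with h0 | h0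
    · rw [starVar_of_not_subset h0]
      refine mul_nonneg ?_ (sum_nonneg fun r _ => starVar_nonneg r F)
      simp [hd1.ne']
    · have : (X.faces (t.card + 0)).filter (t ⊆ ·) = {t} := by
        ext r
        simp only [mem_filter, mem_singleton, mem_faces_iff_starWeight_pos, add_zero]
        constructor
        · rintro ⟨⟨-, hr⟩, htr⟩
          exact (eq_of_subset_of_card_le htr hr.le).symm
        · rintro rfl
          exact ⟨⟨h0, rfl⟩, subset_rfl⟩
      rw [this, sum_singleton]
      simp [hd1.ne']
  | succ m ih =>
    intro t htd
    have htd' : (t.card : ℝ) + (m + 1) + 1 = d := by exact_mod_cast htd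
    have hm : (0 : ℝ) ≤ m := m.cast_nonneg
    have hc : (0 : ℝ) ≤ t.card := t.card.cast_nonneg
    have h1 := sub_mul_pos_of_lt_one (n := d - 1) (x := m) hd1 hlam hm (by linarith)
    have h2 := sub_mul_pos_of_lt_one (n := d - 1) (x := m + 1) hd1 hlam (by linarith)
      (by linarith)
    push_cast
    rcases X.starWeight_eq_zero_or_pos t with h0 | h0
    · rw [starVar_of_not_subset h0]
      exact mul_nonneg (div_nonneg hd1.le h2.le) (sum_nonneg fun r _ => starVar_nonneg r F)
    · have key := (h.linkGapLE hlam m t h0 (by omega)).mul_starVar_le h0 (by omega) F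
      have hle : ∑ v ∈ X.linkVerts t, X.starVar (insert v t) F ≤
          ((d : ℝ) - 1) / ((d : ℝ) - 1 - m * lam) * ((m + 1 : ℕ) *
            ∑ r ∈ X.faces (t.card + (m + 1)) with t ⊆ r, X.starVar r F) := by
        rw [← sum_faces_insert, mul_sum]
        refine (sum_le_sum_of_subset_of_nonneg (filter_subset _ _)
          fun v _ _ => starVar_nonneg _ F).trans (sum_le_sum fun v hv => ?_)
        have hcv : (insert v t).card = t.card + 1 := card_insert_of_notMem (mem_sdiff.1 hv).2
        have := ih (insert v t) (by omega)
        rwa [hcv, add_assoc, add_comm 1 m] at this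
      have h3 := key.trans hle
      rw [one_sub_div h1.ne'] at h3
      set R := ∑ r ∈ X.faces (t.card + (m + 1)) with t ⊆ r, X.starVar r F
      rw [show (d : ℝ) - t.card - 1 = m + 1 by linarith] at h3
      push_cast at h3
      have h4 : (m + 1 : ℝ) * (((d : ℝ) - 1 - (m + 1) * lam) * X.starVar t F) ≤
          (m + 1) * (((d : ℝ) - 1) * R) := by
        have h5 := mul_le_mul_of_nonneg_right h3 h1.le
        have e1 : (m + 1 : ℝ) * (((d : ℝ) - 1 - m * lam - lam) / ((d : ℝ) - 1 - m * lam)) *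
            X.starVar t F * ((d : ℝ) - 1 - m * lam) =
            (m + 1) * (((d : ℝ) - 1 - (m + 1) * lam) * X.starVar t F) := by
          field_simp
          ring
        have e2 : ((d : ℝ) - 1) / ((d : ℝ) - 1 - m * lam) * ((m + 1) * R) *
            ((d : ℝ) - 1 - m * lam) = (m + 1) * (((d : ℝ) - 1) * R) := by
          field_simp
        rwa [e1, e2] at h5
      have h6 := le_of_mul_le_mul_left h4 (by linarith : (0 : ℝ) < m + 1)
      rw [div_mul_eq_mul_div, le_div_iff₀ h2]
      linarith

theorem HasPoincare.mono {C C' : ℝ} (h : X.HasPoincare C) (hC : C ≤ C') : X.HasPoincare C' :=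
  fun F => (h F).trans <|
    mul_le_mul_of_nonneg_right hC (sum_nonneg fun r _ => starVar_nonneg r F)

theorem hasPoincare_of_le_one (hd : d ≤ 1) : X.HasPoincare 1 := by
  intro F
  have : ∅ ∈ X.faces (d - 1) :=
    mem_faces_iff_starWeight_pos.2 ⟨by rw [starWeight_empty]; exact one_pos, by simp; omega⟩
  rw [one_mul]
  exact single_le_sum (f := fun r => X.starVar r F) (fun r _ => starVar_nonneg r F) this

theorem IsTricklingDown.hasPoincare {lam : ℝ} (hlam : lam < 1) (h : X.IsTricklingDown lam) :
    X.HasPoincare (1 + Real.exp (lam / (1 - lam))) := by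
  rcases Nat.lt_or_ge d 2 with hd | hd
  · exact (hasPoincare_of_le_one (by omega)).mono (by linarith [Real.exp_pos (lam / (1 - lam))])
  · have h1 : 0 < 1 - lam := by linarith
    have h2 : X.HasPoincare (1 / (1 - lam)) := by
      intro F
      have key := h.starVar_le hlam hd F (d - 1) ∅ (by simp; omega)
      have hd1 : ((d - 1 : ℕ) : ℝ) = (d : ℝ) - 1 := by
        rw [Nat.cast_sub (by omega), Nat.cast_one]
      have hd2 : (d : ℝ) - 1 ≠ 0 := by
        have : (2 : ℝ) ≤ d := by exact_mod_cast hd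
        linarith
      rw [hd1, show (d : ℝ) - 1 - (d - 1) * lam = (d - 1) * (1 - lam) by ring,
        div_mul_cancel_left₀ hd2] at key
      simpa using key
    refine h2.mono ?_
    have h3 := Real.add_one_le_exp (lam / (1 - lam))
    have h4 : lam / (1 - lam) + 1 = 1 / (1 - lam) := by field_simp; ring
    linarith

end WeightedComplex

namespace WeightedComplex

variable {V : Type*} [DecidableEq V] {d : ℕ} {X : WeightedComplex V d}

/-! ### The down-up walk -/

theorem sum_faces_starSum (k : ℕ) (φ : Finset V → Finset V → ℝ) :
    ∑ r ∈ X.faces k, X.starSum r (φ r) = X.starSum ∅ fun s => ∑ r ∈ s.powersetCard k, φ r s := by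
  simp only [starSum, mul_sum]
  refine sum_comm' fun r s => ?_
  simp only [mem_filter, mem_powersetCard, mem_faces, empty_subset, and_true]
  exact ⟨fun ⟨⟨_, hk⟩, hs, hrs⟩ => ⟨⟨hrs, hk⟩, hs⟩, fun ⟨⟨hrs, hk⟩, hs⟩ => ⟨⟨⟨s, hs, hrs⟩, hk⟩, hs, hrs⟩⟩

theorem faces_self : X.faces d = X.top := by
  ext s
  rw [mem_faces]
  constructor
  · rintro ⟨⟨t, ht, hst⟩, hs⟩
    rwa [eq_of_subset_of_card_le hst (by rw [X.card_of_mem_top t ht, hs])]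
  · exact fun hs => ⟨⟨s, hs, subset_rfl⟩, X.card_of_mem_top s hs⟩

theorem prob_eq {k : ℕ} {s : Finset V} (hs : s.card = k) :
    X.prob s = X.starWeight s / (d.choose k : ℕ) := by
  rw [prob, starWeight, hs]

theorem prob_nonneg (s : Finset V) : 0 ≤ X.prob s :=
  div_nonneg (starWeight_nonneg s) (Nat.cast_nonneg _)

theorem prob_of_mem_top {s : Finset V} (hs : s ∈ X.top) : X.prob s = X.density s := by
  have : X.top.filter (s ⊆ ·) = {s} := by
    ext t
    simp only [mem_filter, mem_singleton]
    constructor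
    · rintro ⟨ht, hst⟩
      exact (eq_of_subset_of_card_le hst
        (by rw [X.card_of_mem_top t ht, X.card_of_mem_top s hs])).symm
    · rintro rfl
      exact ⟨hs, subset_rfl⟩
  rw [prob, this, sum_singleton, X.card_of_mem_top s hs, Nat.choose_self, Nat.cast_one, div_one]

theorem starSum_empty (F : Finset V → ℝ) : X.starSum ∅ F = ∑ s ∈ X.top, X.density s * F s := by
  simp [starSum]

theorem sum_top_prob_mul (φ : Finset V → ℝ) :
    ∑ s ∈ X.top, X.prob s * φ s = ∑ s ∈ X.top, X.density s * φ s :=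
  sum_congr rfl fun s hs => by rw [prob_of_mem_top hs]

theorem downUp_eq (hd : 1 ≤ d) (F : Finset V → ℝ) (s : Finset V) :
    X.downUp d F s = (∑ r ∈ s.powersetCard (d - 1), X.starSum r F / X.starWeight r) / d := by
  have hch : d.choose (d - 1) = d := by
    rw [Nat.choose_symm hd, Nat.choose_one_right]
  have hd0 : (d : ℝ) ≠ 0 := by exact_mod_cast (by omega : d ≠ 0)
  rw [downUp, upOp, hch]
  congr 1
  refine sum_congr rfl fun r hr => ?_
  rw [downOp, faces_self, starSum, sum_div]
  refine sum_congr rfl fun t ht => ?_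
  rw [prob_of_mem_top (mem_filter.1 ht).1, prob_eq (mem_powersetCard.1 hr).2, hch,
    mul_div_cancel₀ _ hd0, div_mul_eq_mul_div]

theorem sum_density_mul_downUp (hd : 1 ≤ d) (F G : Finset V → ℝ) :
    (d : ℝ) * ∑ s ∈ X.top, X.density s * (F s * X.downUp d G s) =
      ∑ r ∈ X.faces (d - 1), X.starSum r F * X.starSum r G / X.starWeight r := by
  have hd0 : (d : ℝ) ≠ 0 := by exact_mod_cast (by omega : d ≠ 0)
  have h1 : ∀ r, X.starSum r F * X.starSum r G / X.starWeight r =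
      X.starSum r fun s => X.starSum r G / X.starWeight r * F s := fun r => by
    rw [starSum_const_mul]
    ring
  rw [sum_congr rfl fun r _ => h1 r, sum_faces_starSum, starSum_empty, mul_sum]
  refine sum_congr rfl fun s hs => ?_
  rw [downUp_eq hd, ← sum_mul]
  field_simp

theorem sum_starVar_eq (hd : 1 ≤ d) (F : Finset V → ℝ) :
    ∑ r ∈ X.faces (d - 1), X.starVar r F = d * (∑ s ∈ X.top, X.density s * F s ^ 2 -
      ∑ s ∈ X.top, X.density s * (F s * X.downUp d F s)) := by
  rw [mul_sub, sum_density_mul_downUp hd, ← starSum_empty fun s => F s ^ 2, ← starSum_const_mul]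
  simp only [starVar]
  rw [sum_sub_distrib, sum_faces_starSum _ fun _ s => F s ^ 2]
  congr 1
  · refine starSum_congr fun s hs _ => ?_
    rw [sum_const, nsmul_eq_mul, card_powersetCard, X.card_of_mem_top s hs, Nat.choose_symm hd,
      Nat.choose_one_right]
  · simp only [sq]

theorem hasPoincare_of_secondEigenvalueLE {C : ℝ} (hC : 0 < C)
    (h : SecondEigenvalueLE (X.faces d) X.prob (X.downUp d) (1 - 1 / (C * d))) :
    X.HasPoincare (C + 1) := by
  rcases Nat.lt_or_ge d 1 with hd | hd
  · exact (hasPoincare_of_le_one (by omega)).mono (by linarith)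
  have hd0 : (0 : ℝ) < d := by exact_mod_cast hd
  refine HasPoincare.mono (C := C) (fun F => ?_) (by linarith)
  rw [faces_self] at h
  set m := X.starSum ∅ F with hm
  have hmean : ∑ s ∈ X.top, X.density s * (F s - m) = 0 := by
    rw [← starSum_empty fun s => F s - m, starSum_sub, starSum_const, starWeight_empty, hm]
    ring
  have key := h.sum_mul_le
    (fun s hs => by rw [prob_of_mem_top hs]; exact X.density_pos s hs)
    (fun f g hfg s _ => by
      rw [downUp_eq hd, downUp_eq hd]
      simp only [fun r => starSum_congr (X := X) (t := r) fun s hs _ => hfg s hs])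
    (fun f g s _ => by
      simp only [downUp_eq hd, Pi.add_def, starSum_add, add_div, sum_add_distrib])
    (fun a f s _ => by
      simp only [downUp_eq hd, Pi.smul_def, smul_eq_mul, starSum_const_mul, mul_div_assoc,
        ← mul_sum])
    (fun f g => by
      rw [sum_top_prob_mul fun s => f s * X.downUp d g s,
        sum_top_prob_mul fun s => X.downUp d f s * g s]
      refine mul_left_cancel₀ hd0.ne' ?_
      rw [sum_density_mul_downUp hd]
      simp only [mul_comm (X.downUp d f _)]
      rw [sum_density_mul_downUp hd]
      simp only [mul_comm])
    (fun s hs => by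
      rw [downUp_eq hd, sum_congr rfl fun r hr => by
        rw [starSum_const, one_mul,
          div_self (starWeight_pos hs (mem_powersetCard.1 hr).1).ne'], sum_const, nsmul_eq_mul,
        card_powersetCard, X.card_of_mem_top s hs, Nat.choose_symm hd, Nat.choose_one_right,
        mul_one, div_self hd0.ne'])
    (fun s => F s - m)
    (by rw [← hmean, sum_top_prob_mul])
  rw [sum_top_prob_mul fun s => (F s - m) * X.downUp d (fun s => F s - m) s,
    sum_top_prob_mul fun s => (F s - m) ^ 2] at key
  have hV : X.starVar ∅ F = ∑ s ∈ X.top, X.density s * (F s - m) ^ 2 := by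
    rw [← starSum_empty fun s => (F s - m) ^ 2,
      starSum_sub_sq (by rw [starWeight_empty]; exact one_pos), starWeight_empty, hm]
    ring
  rw [sum_congr rfl fun r _ => (starVar_sub_const r F m).symm, sum_starVar_eq hd, hV]
  set Q := ∑ s ∈ X.top, X.density s * (F s - m) ^ 2
  set R := ∑ s ∈ X.top, X.density s * ((F s - m) * X.downUp d (fun s => F s - m) s)
  have h1 : C * (d * R) ≤ C * (d * Q) - Q := by
    have h2 := mul_le_mul_of_nonneg_left key (mul_pos hC hd0).le
    have h3 : C * d * ((1 - 1 / (C * d)) * Q) = C * (d * Q) - Q := by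
      field_simp
    rw [h3] at h2
    linarith
  linarith

/-! ### Variance bounds on the lower levels -/

/-- The random quadratic variation of `g` under resampling single vertices of a `k`-face, each at
the worst possible value, is bounded by the function `w` of the face. -/
def ResampleBound (X : WeightedComplex V d) (k : ℕ) (w g : Finset V → ℝ) : Prop :=
  ∀ s ∈ X.faces k, ∀ z : V → V,
    (∀ x ∈ s, z x ∉ s.erase x ∧ insert (z x) (s.erase x) ∈ X.faces k) →
      ∑ x ∈ s, (max (g s - g (insert (z x) (s.erase x))) 0) ^ 2 ≤ w s

theorem IsLipschitz.resampleBound {k : ℕ} {ν : ℝ} {f : Finset V → ℝ} (h : X.IsLipschitz k ν f) :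
    X.ResampleBound k (fun _ => ν) f := by
  intro s hs z hz
  refine h s hs z fun x hx => ?_
  obtain ⟨h1, h2⟩ := hz x hx
  have hp : 0 < X.prob (insert (z x) (s.erase x)) :=
    pos_of_mul_pos_left (X.prob_mul_choose_pos h2) (Nat.cast_nonneg _)
  obtain ⟨⟨t, ht, hsub⟩, -⟩ := mem_faces.1 h2
  rw [resampleProb, if_neg h1]
  exact div_pos hp (sum_pos' (fun y _ => prob_nonneg _)
    ⟨z x, mem_sdiff.2 ⟨top_subset_verts ht (hsub (mem_insert_self _ _)), h1⟩, hp⟩)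

theorem ResampleBound.nonneg {k : ℕ} {w g : Finset V → ℝ} (h : X.ResampleBound k w g)
    {s : Finset V} (hs : s ∈ X.faces k) : 0 ≤ w s :=
  (sum_nonneg fun _ _ => sq_nonneg _).trans
    (h s hs id fun x hx => ⟨notMem_erase x s, by rwa [id, insert_erase hx]⟩)

theorem mean_eq_starSum (k : ℕ) (F : Finset V → ℝ) :
    X.mean k F = X.starSum ∅ fun s => (d.choose k : ℝ)⁻¹ * ∑ r ∈ s.powersetCard k, F r := by
  rw [starSum_const_mul, ← sum_faces_starSum k fun r _ => F r, mean, mul_sum]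
  refine sum_congr rfl fun s hs => ?_
  rw [starSum_const, prob_eq (mem_faces.1 hs).2]
  ring

theorem mean_self (F : Finset V → ℝ) : X.mean d F = X.starSum ∅ F := by
  rw [mean, faces_self, starSum_empty]
  exact sum_congr rfl fun s hs => by rw [prob_of_mem_top hs]

theorem mean_mono {k : ℕ} {F G : Finset V → ℝ} (h : ∀ s ∈ X.faces k, F s ≤ G s) :
    X.mean k F ≤ X.mean k G :=
  sum_le_sum fun s hs => mul_le_mul_of_nonneg_left (h s hs) (prob_nonneg s)

theorem mean_const_mul (k : ℕ) (a : ℝ) (F : Finset V → ℝ) :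
    X.mean k (fun s => a * F s) = a * X.mean k F := by
  simp only [mean, mul_sum, mul_left_comm]

theorem mean_sub (k : ℕ) (F G : Finset V → ℝ) :
    X.mean k (fun s => F s - G s) = X.mean k F - X.mean k G := by
  simp only [mean, mul_sub, sum_sub_distrib]

theorem sum_prob {k : ℕ} (hk : k ≤ d) : ∑ s ∈ X.faces k, X.prob s = 1 := by
  have h := mean_eq_starSum (X := X) k fun _ => 1
  have hc : (d.choose k : ℝ) ≠ 0 := by exact_mod_cast (Nat.choose_pos hk).ne'
  rw [starSum_congr (G := fun _ => 1) fun s hs _ => by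
    rw [sum_const, nsmul_eq_mul, mul_one, card_powersetCard, X.card_of_mem_top s hs,
      inv_mul_cancel₀ hc], starSum_const, starWeight_empty, mean] at h
  simpa using h

/-- The mean of `g` over the `k`-subsets of a `(k + 1)`-face. -/
def eraseAvg (k : ℕ) (g : Finset V → ℝ) (t : Finset V) : ℝ :=
  (∑ y ∈ t, g (t.erase y)) / (k + 1)

theorem sum_powersetCard_succ_sum_erase (s : Finset V) (k : ℕ) (g : Finset V → ℝ) :
    ∑ t ∈ s.powersetCard (k + 1), ∑ y ∈ t, g (t.erase y) =
      ∑ r ∈ s.powersetCard k, ∑ _y ∈ s \ r, g r := by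
  rw [sum_sigma', sum_sigma']
  refine sum_bij' (fun p _ => ⟨p.1.erase p.2, p.2⟩) (fun p _ => ⟨insert p.2 p.1, p.2⟩) ?_ ?_ ?_ ?_ ?_
  · rintro ⟨t, y⟩ h
    simp only [mem_sigma, mem_powersetCard, mem_sdiff] at h ⊢
    exact ⟨⟨(erase_subset _ _).trans h.1.1, by rw [card_erase_of_mem h.2, h.1.2]; rfl⟩,
      h.1.1 h.2, notMem_erase _ _⟩
  · rintro ⟨r, y⟩ h
    simp only [mem_sigma, mem_powersetCard, mem_sdiff] at h ⊢
    exact ⟨⟨insert_subset h.2.1 h.1.1, by rw [card_insert_of_notMem h.2.2, h.1.2]⟩,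
      mem_insert_self _ _⟩
  · rintro ⟨t, y⟩ h
    simp only [mem_sigma] at h
    simp [insert_erase h.2]
  · rintro ⟨r, y⟩ h
    simp only [mem_sigma, mem_sdiff] at h
    simp [erase_insert h.2.2]
  · rintro ⟨t, y⟩ _
    rfl

theorem mean_succ_eraseAvg {k : ℕ} (hk : k + 1 ≤ d) (g : Finset V → ℝ) :
    X.mean (k + 1) (eraseAvg k g) = X.mean k g := by
  rw [mean_eq_starSum, mean_eq_starSum]
  refine starSum_congr fun s hs _ => ?_
  have h1 : ∑ t ∈ s.powersetCard (k + 1), eraseAvg k g t =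
      ((d : ℝ) - k) * (∑ r ∈ s.powersetCard k, g r) / (k + 1) := by
    simp only [eraseAvg]
    rw [← sum_div, sum_powersetCard_succ_sum_erase, mul_sum]
    congr 1
    refine sum_congr rfl fun r hr => ?_
    rw [sum_const, nsmul_eq_mul, card_sdiff_of_mem_top hs (mem_powersetCard.1 hr).1,
      (mem_powersetCard.1 hr).2]
  have h2 : (d.choose (k + 1) : ℝ) * (k + 1) = d.choose k * ((d : ℝ) - k) := by
    rw [← Nat.cast_sub (by omega)]
    exact_mod_cast Nat.choose_succ_right_eq d k
  have h3 : (d.choose (k + 1) : ℝ) ≠ 0 := by exact_mod_cast (Nat.choose_pos hk).ne'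
  have h4 : (d.choose k : ℝ) ≠ 0 := by exact_mod_cast (Nat.choose_pos (by omega)).ne'
  have h5 : (k : ℝ) + 1 ≠ 0 := by positivity
  rw [h1]
  field_simp
  linear_combination (-∑ r ∈ s.powersetCard k, g r) * h2

/-- Averaging contracts the quadratic variation: a vertex of a `(k + 1)`-face lies in a random
`k`-subset of it only with probability `k / (k + 1)`. -/
theorem ResampleBound.average {k : ℕ} {w g : Finset V → ℝ} (h : X.ResampleBound k w g) :
    X.ResampleBound (k + 1) (fun t => (k : ℝ) / (k + 1) * eraseAvg k w t) (eraseAvg k g) := by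
  intro t ht z hz
  have htc := (mem_faces.1 ht).2
  have hk : (0 : ℝ) < (k : ℝ) + 1 := by positivity
  let a : V → V → ℝ := fun x y =>
    max (g (t.erase y) - g (insert (z x) ((t.erase y).erase x))) 0
  have hxy : ∀ x, ∀ y ∈ t.erase x, z x ∉ t.erase x →
      (insert (z x) (t.erase x)).erase y = insert (z x) ((t.erase y).erase x) := by
    intro x y hy hzx
    rw [erase_insert_of_ne (fun h => hzx (by rwa [h])), erase_right_comm]
  have hx : ∀ x ∈ t,
      (max (eraseAvg k g t -
        eraseAvg k g (insert (z x) (t.erase x))) 0) ^ 2 ≤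
        (k : ℝ) / (k + 1) ^ 2 * ∑ y ∈ t.erase x, a x y ^ 2 := by
    intro x hx
    obtain ⟨hzx, -⟩ := hz x hx
    have e1 : eraseAvg k g t -
        eraseAvg k g (insert (z x) (t.erase x)) =
        (∑ y ∈ t.erase x, (g (t.erase y) - g (insert (z x) ((t.erase y).erase x)))) / (k + 1) := by
      rw [eraseAvg, eraseAvg, sum_insert hzx, erase_insert hzx,
        ← add_sum_erase _ _ hx, sum_sub_distrib,
        sum_congr rfl fun y hy => congrArg g (hxy x y hy hzx)]
      ring
    have e2 : max (eraseAvg k g t -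
        eraseAvg k g (insert (z x) (t.erase x))) 0 ≤
        (∑ y ∈ t.erase x, a x y) / (k + 1) := by
      refine max_le ?_ (div_nonneg (sum_nonneg fun y _ => le_max_right _ _) hk.le)
      rw [e1]
      exact div_le_div_of_nonneg_right (sum_le_sum fun y _ => le_max_left _ _) hk.le
    refine (pow_le_pow_left₀ (le_max_right _ _) e2 2).trans ?_
    have e3 := sq_sum_le_card_mul_sum_sq (s := t.erase x) (f := a x)
    rw [card_erase_of_mem hx, htc, Nat.add_sub_cancel] at e3
    rw [div_pow, div_mul_eq_mul_div]
    exact div_le_div_of_nonneg_right e3 (by positivity)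
  refine (sum_le_sum hx).trans ?_
  rw [← mul_sum]
  have hcomm : ∑ x ∈ t, ∑ y ∈ t.erase x, a x y ^ 2 = ∑ y ∈ t, ∑ x ∈ t.erase y, a x y ^ 2 := by
    refine sum_comm' fun x y => ?_
    simp only [mem_erase]
    tauto
  have hle : ∑ y ∈ t, ∑ x ∈ t.erase y, a x y ^ 2 ≤ ∑ y ∈ t, w (t.erase y) := by
    refine sum_le_sum fun y hy => ?_
    obtain ⟨⟨u, hu, htu⟩, -⟩ := mem_faces.1 ht
    have hyc : (t.erase y).card = k := by rw [card_erase_of_mem hy, htc, Nat.add_sub_cancel]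
    refine h (t.erase y) (mem_faces.2 ⟨⟨u, hu, (erase_subset _ _).trans htu⟩, hyc⟩) z
      fun x hx => ?_
    obtain ⟨hxy', hxt⟩ := mem_erase.1 hx
    obtain ⟨hzx, hzf⟩ := hz x hxt
    have hyx : y ∈ t.erase x := mem_erase.2 ⟨hxy'.symm, hy⟩
    refine ⟨fun hc => hzx (erase_subset_erase x (erase_subset y t) hc), ?_⟩
    rw [← hxy x y hyx hzx]
    obtain ⟨⟨u', hu', htu'⟩, hc'⟩ := mem_faces.1 hzf
    refine mem_faces.2 ⟨⟨u', hu', (erase_subset _ _).trans htu'⟩, ?_⟩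
    rw [card_erase_of_mem (mem_insert_of_mem hyx), hc', Nat.add_sub_cancel]
  rw [hcomm]
  refine (mul_le_mul_of_nonneg_left hle (by positivity)).trans_eq ?_
  simp only [eraseAvg]
  field_simp

theorem sum_sum_max_sub_sq {ι : Type*} (t : Finset ι) (a : ι → ℝ) :
    ∑ y ∈ t, ∑ x ∈ t, (max (a y - a x) 0) ^ 2 = t.card * ∑ y ∈ t, a y ^ 2 - (∑ y ∈ t, a y) ^ 2 := by
  have h1 : ∑ y ∈ t, ∑ x ∈ t, (max (a y - a x) 0) ^ 2 =
      ∑ y ∈ t, ∑ x ∈ t, (max (a x - a y) 0) ^ 2 := sum_comm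
  have h2 : ∑ y ∈ t, ∑ x ∈ t, (a y - a x) ^ 2 =
      ∑ y ∈ t, ∑ x ∈ t, (max (a y - a x) 0) ^ 2 + ∑ y ∈ t, ∑ x ∈ t, (max (a x - a y) 0) ^ 2 := by
    simp only [← sum_add_distrib]
    refine sum_congr rfl fun y _ => sum_congr rfl fun x _ => ?_
    rcases le_total (a x) (a y) with h | h
    · rw [max_eq_left (sub_nonneg.2 h), max_eq_right (sub_nonpos.2 h)]
      ring
    · rw [max_eq_right (sub_nonpos.2 h), max_eq_left (sub_nonneg.2 h)]
      ring
  have h3 : ∑ y ∈ t, ∑ x ∈ t, (a y - a x) ^ 2 =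
      2 * (t.card * ∑ y ∈ t, a y ^ 2 - (∑ y ∈ t, a y) ^ 2) := by
    simp only [sub_sq, sum_add_distrib, sum_sub_distrib, sum_const, nsmul_eq_mul, ← mul_sum,
      ← sum_mul]
    ring
  linarith

/-- The variance of `g` over the `k`-subsets of a `(k + 1)`-face: exchanging the omitted vertex `y`
for another one is a resampling that moves every vertex to `y`. -/
theorem ResampleBound.average_sq_sub_le {k : ℕ} {w g : Finset V → ℝ}
    (h : X.ResampleBound k w g) {t : Finset V} (ht : t ∈ X.faces (k + 1)) :
    eraseAvg k (fun s => g s ^ 2) t - eraseAvg k g t ^ 2 ≤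
      1 / (k + 1) * eraseAvg k w t := by
  obtain ⟨⟨u, hu, htu⟩, htc⟩ := mem_faces.1 ht
  have hk : (0 : ℝ) < (k : ℝ) + 1 := by positivity
  have h1 := sum_sum_max_sub_sq t fun y => g (t.erase y)
  rw [htc] at h1
  push_cast at h1
  have hface : ∀ y ∈ t, t.erase y ∈ X.faces k := fun y hy =>
    mem_faces.2 ⟨⟨u, hu, (erase_subset _ _).trans htu⟩,
      by rw [card_erase_of_mem hy, htc, Nat.add_sub_cancel]⟩
  have h2 : ∑ y ∈ t, ∑ x ∈ t, (max (g (t.erase y) - g (t.erase x)) 0) ^ 2 ≤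
      ∑ y ∈ t, w (t.erase y) := by
    refine sum_le_sum fun y hy => ?_
    have h3 : ∀ x ∈ t.erase y, insert y ((t.erase y).erase x) = t.erase x := fun x hx => by
      rw [erase_right_comm, insert_erase (mem_erase.2 ⟨(mem_erase.1 hx).1.symm, hy⟩)]
    have h4 := h (t.erase y) (hface y hy) (fun _ => y) fun x hx =>
      ⟨fun hc => notMem_erase y t (mem_of_mem_erase hc), by
        rw [h3 x hx]; exact hface x (mem_erase.1 hx).2⟩
    rw [sum_congr rfl fun x hx => by rw [h3 x hx]] at h4
    rw [← add_sum_erase _ _ hy, sub_self, max_self, zero_pow two_ne_zero, zero_add]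
    exact h4
  rw [h1] at h2
  simp only [eraseAvg]
  have h5 : (∑ y ∈ t, g (t.erase y) ^ 2) / ((k : ℝ) + 1) -
      ((∑ y ∈ t, g (t.erase y)) / (k + 1)) ^ 2 =
      (((k : ℝ) + 1) * ∑ y ∈ t, g (t.erase y) ^ 2 - (∑ y ∈ t, g (t.erase y)) ^ 2) /
        ((k : ℝ) + 1) ^ 2 := by
    field_simp
  have h6 : 1 / ((k : ℝ) + 1) * ((∑ y ∈ t, w (t.erase y)) / (k + 1)) =
      (∑ y ∈ t, w (t.erase y)) / ((k : ℝ) + 1) ^ 2 := by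
    field_simp
  rw [h5, h6]
  exact div_le_div_of_nonneg_right h2 (by positivity)

/-- The sum over `r` of the conditional variances, on the top level. Given `r`, the variance is at
most the second moment about the minimum, and this is attained by some resampled vertex. -/
theorem ResampleBound.sum_starVar_le (hd : 1 ≤ d) {w g : Finset V → ℝ}
    (h : X.ResampleBound d w g) :
    ∑ r ∈ X.faces (d - 1), X.starVar r g ≤ X.mean d w := by
  have hmin : ∀ r ∈ X.faces (d - 1), ∃ t ∈ X.top, r ⊆ t ∧ ∀ s ∈ X.top, r ⊆ s → g t ≤ g s := by
    intro r hr
    obtain ⟨⟨u, hu, hru⟩, -⟩ := mem_faces.1 hr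
    obtain ⟨t, ht, htm⟩ := exists_min_image (X.top.filter (r ⊆ ·)) g ⟨u, mem_filter.2 ⟨hu, hru⟩⟩
    exact ⟨t, (mem_filter.1 ht).1, (mem_filter.1 ht).2,
      fun s hs hrs => htm s (mem_filter.2 ⟨hs, hrs⟩)⟩
  choose! m hmt hrm hmle using hmin
  refine (sum_le_sum fun r _ => starVar_le_starSum_sub_sq r g (g (m r))).trans ?_
  rw [sum_faces_starSum, mean_self]
  refine starSum_mono fun s hs _ => ?_
  have hsc := X.card_of_mem_top s hs
  have hpow : s.powersetCard (d - 1) = s.image s.erase := by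
    ext r
    simp only [mem_powersetCard, mem_image]
    constructor
    · rintro ⟨hrs, hrc⟩
      obtain ⟨x, hx, rfl⟩ := exists_eq_insert_iff.2 ⟨hrs, by omega⟩
      exact ⟨x, mem_insert_self x r, erase_insert hx⟩
    · rintro ⟨x, hx, rfl⟩
      exact ⟨erase_subset x s, by rw [card_erase_of_mem hx, hsc]⟩
  rw [hpow, sum_image (erase_injOn s)]
  have hface : ∀ x ∈ s, s.erase x ∈ X.faces (d - 1) := fun x hx =>
    mem_faces.2 ⟨⟨s, hs, erase_subset x s⟩, by rw [card_erase_of_mem hx, hsc]⟩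
  have hz : ∀ x ∈ s, ∃ y, y ∉ s.erase x ∧ insert y (s.erase x) = m (s.erase x) := fun x hx =>
    exists_eq_insert_iff.2 ⟨hrm _ (hface x hx), by
      rw [X.card_of_mem_top _ (hmt _ (hface x hx)), card_erase_of_mem hx, hsc]; omega⟩
  choose! z hz1 hz2 using hz
  refine le_trans (sum_le_sum fun x hx => ?_) (h s (by rwa [faces_self]) z fun x hx =>
    ⟨hz1 x hx, by rw [hz2 x hx, faces_self]; exact hmt _ (hface x hx)⟩)
  rw [hz2 x hx, max_eq_left (sub_nonneg.2 (hmle _ (hface x hx) s hs (erase_subset x s)))]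

/-- The variance inequality on `X(k)`, by descent from the top level. Passing from `k + 1` to `k`,
the variance of `g` splits into that of its averages over the `k`-subsets of a `(k + 1)`-face and
the mean variance over these subsets; the two parts account for `k / (k + 1)` and `1 / (k + 1)` of
the bound. -/
theorem HasPoincare.variance_le {c : ℝ} (hX : X.HasPoincare c) (hc : 1 ≤ c) {k : ℕ} (hk : k ≤ d) :
    ∀ {w g : Finset V → ℝ}, X.ResampleBound k w g →
      X.mean k (fun s => g s ^ 2) - X.mean k g ^ 2 ≤ c * X.mean k w := by
  induction hk using Nat.decreasingInduction with
  | self =>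
    intro w g h
    have h1 : X.mean d (fun s => g s ^ 2) - X.mean d g ^ 2 = X.starVar ∅ g := by
      rw [mean_self, mean_self, starVar, starWeight_empty, div_one]
    rw [h1]
    rcases Nat.eq_zero_or_pos d with hd | hd
    · rw [starVar_eq_zero_of_card_eq (by rw [hd, card_empty])]
      exact mul_nonneg (by linarith)
        (sum_nonneg fun s hs => mul_nonneg (prob_nonneg s) (h.nonneg hs))
    · exact (hX g).trans (mul_le_mul_of_nonneg_left (h.sum_starVar_le hd) (by linarith))
  | of_succ k hk ih =>
    intro w g h
    have h1 := ih h.average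
    have h2 := mean_mono fun t ht => h.average_sq_sub_le (t := t) ht
    rw [mean_sub, mean_const_mul, mean_succ_eraseAvg hk, mean_succ_eraseAvg hk] at h2
    rw [mean_const_mul, mean_succ_eraseAvg hk, mean_succ_eraseAvg hk] at h1
    have hw : 0 ≤ X.mean k w :=
      sum_nonneg fun s hs => mul_nonneg (prob_nonneg s) (h.nonneg hs)
    have hk0 : (0 : ℝ) < (k : ℝ) + 1 := by positivity
    have h3 : 1 / ((k : ℝ) + 1) * X.mean k w ≤ c * (1 / (k + 1) * X.mean k w) :=
      le_mul_of_one_le_left (by positivity) hc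
    have h4 : c * ((k : ℝ) / (k + 1) * X.mean k w) + c * (1 / (k + 1) * X.mean k w) =
        c * X.mean k w := by
      field_simp
    linarith

end WeightedComplex

/-! ### Exponential tails from a recursion for the moment generating function -/

theorem exp_le_one_add_self_add_sq_mul_exp_abs (x : ℝ) :
    Real.exp x ≤ 1 + x + x ^ 2 * Real.exp |x| := by
  have h1 : 1 ≤ Real.exp |x| := Real.one_le_exp (abs_nonneg x)
  rcases le_total |x| 1 with hx | hx
  · have := (abs_le.1 (Real.abs_exp_sub_one_sub_id_le hx)).2
    nlinarith [sq_nonneg x]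
  · have hx2 : 1 ≤ x ^ 2 := by rw [← sq_abs]; nlinarith
    rcases le_total 0 x with h0 | h0
    · rw [abs_of_nonneg h0] at *
      nlinarith
    · rw [abs_of_nonpos h0] at *
      have : Real.exp x ≤ 1 := Real.exp_le_one_iff.2 h0
      nlinarith

/-- The chord bound for the convex function `exp - 1` on `[0, b]`. -/
theorem exp_mul_sub_one_le {b r : ℝ} (hr0 : 0 ≤ r) (hr1 : r ≤ 1) :
    Real.exp (r * b) - 1 ≤ r * (Real.exp b - 1) := by
  have := convexOn_exp.2 (Set.mem_univ 0) (Set.mem_univ b) (sub_nonneg.2 hr1) hr0 (by ring)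
  simp only [smul_eq_mul, mul_zero, zero_add, Real.exp_zero] at this
  linarith

theorem exp_half_sub_one_sq_le : (Real.exp (1 / 2) - 1) ^ 2 ≤ 0.421 := by
  have h : Real.exp (1 / 2) ^ 2 = Real.exp 1 := by rw [← Real.exp_nat_mul]; norm_num
  have h1 := Real.exp_one_lt_d9
  have h0 : 0 ≤ Real.exp (1 / 2) - 1 := by linarith [Real.add_one_le_exp (1 / 2 : ℝ)]
  have : Real.exp (1 / 2) ≤ 1.6488 := by
    by_contra! hc
    nlinarith
  nlinarith

theorem exp_quarter_sub_one_sq_le : (Real.exp (1 / 4) - 1) ^ 2 ≤ 0.081 := by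
  have h : Real.exp (1 / 4) ^ 4 = Real.exp 1 := by rw [← Real.exp_nat_mul]; norm_num
  have h1 := Real.exp_one_lt_d9
  have h0 : 0 ≤ Real.exp (1 / 4) - 1 := by linarith [Real.add_one_le_exp (1 / 4 : ℝ)]
  have : Real.exp (1 / 4) ≤ 1.2843 := by
    by_contra! hc
    have := pow_le_pow_left₀ (by norm_num) hc.le 4
    norm_num at this
    linarith
  nlinarith

theorem exp_bounds_eleven_quarters :
    15 ≤ Real.exp (11 / 4) ∧ Real.exp (11 / 4) ≤ 17 := by
  have h : Real.exp (11 / 4) ^ 4 = Real.exp 1 ^ 11 := by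
    rw [← Real.exp_nat_mul, ← Real.exp_nat_mul]; norm_num
  have h1 := pow_le_pow_left₀ (by norm_num) Real.exp_one_gt_d9.le 11
  have h2 := pow_le_pow_left₀ (Real.exp_pos 1).le Real.exp_one_lt_d9.le 11
  rw [← h] at h1 h2
  constructor
  · by_contra! hc
    have := pow_le_pow_left₀ (Real.exp_pos _).le hc.le 4
    norm_num at this h1
    linarith
  · by_contra! hc
    have := pow_le_pow_left₀ (by norm_num) hc.le 4
    norm_num at this h2
    linarith

theorem inv_one_add_sq_le_two_mul_exp_neg {x : ℝ} (hx : x ≤ 11 / 4) :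
    1 / (1 + x ^ 2) ≤ 2 * Real.exp (-x) := by
  have hd : ∀ y : ℝ, HasDerivAt (fun y => (1 + y ^ 2) * Real.exp (-y))
      (-((y - 1) ^ 2 * Real.exp (-y))) y := fun y => by
    have h1 : HasDerivAt (fun y : ℝ => 1 + y ^ 2) (2 * y) y := by
      simpa using (hasDerivAt_pow 2 y).const_add 1
    have h2 : HasDerivAt (fun y : ℝ => Real.exp (-y)) (Real.exp (-y) * -1) y :=
      (hasDerivAt_neg y).exp
    refine (h1.mul h2).congr_deriv ?_
    ring
  have hanti : Antitone fun y : ℝ => (1 + y ^ 2) * Real.exp (-y) :=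
    antitone_of_deriv_nonpos (fun y => (hd y).differentiableAt) fun y => by
      rw [(hd y).deriv]
      have := Real.exp_pos (-y)
      simp only [Left.neg_nonpos_iff]
      positivity
  have h1 : (1 + (11 / 4) ^ 2) * Real.exp (-(11 / 4)) ≤ (1 + x ^ 2) * Real.exp (-x) := hanti hx
  have h2 : 1 / 2 ≤ (1 + (11 / 4) ^ 2) * Real.exp (-(11 / 4)) := by
    rw [Real.exp_neg, ← div_eq_mul_inv, div_le_div_iff₀ (by norm_num) (Real.exp_pos _)]
    linarith [exp_bounds_eleven_quarters.2]
  rw [div_le_iff₀ (by positivity)]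
  linarith

theorem four_add_four_mul_le_exp {x : ℝ} (hx : 11 / 4 ≤ x) : 4 + 4 * x ≤ Real.exp x := by
  have h : Real.exp x = Real.exp (11 / 4) * Real.exp (x - 11 / 4) := by
    rw [← Real.exp_add]; congr 1; ring
  have h1 := Real.add_one_le_exp (x - 11 / 4)
  have h2 := exp_bounds_eleven_quarters.1
  rw [h]
  nlinarith

section Tail

variable {α : Type*} {S : Finset α} {p Y : α → ℝ}

/-- If the moment generating function `M` of a centred random variable satisfies
`M(θ) - M(θ/2)² ≤ (e^{θ/2} - 1)² M(θ)`, then `M(1) ≤ 5/2`. On `[0, 1/2]` the recursion improves a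
bound `M(θ) ≤ exp (B θ²)` to `M(θ) ≤ exp ((B/2 + b₀) θ²)`, and iterating it brings the constant
down to `2 b₀`, whatever it was at the start. -/
theorem sum_mul_exp_le_of_recursion (hp : ∀ x ∈ S, 0 ≤ p x) (hp1 : ∑ x ∈ S, p x = 1)
    (hY : ∑ x ∈ S, p x * Y x = 0)
    (hrec : ∀ θ : ℝ, 0 ≤ θ → θ ≤ 1 →
      ∑ x ∈ S, p x * Real.exp (θ * Y x) - (∑ x ∈ S, p x * Real.exp (θ / 2 * Y x)) ^ 2 ≤
        (Real.exp (θ / 2) - 1) ^ 2 * ∑ x ∈ S, p x * Real.exp (θ * Y x)) :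
    ∑ x ∈ S, p x * Real.exp (Y x) ≤ 5 / 2 := by
  set M : ℝ → ℝ := fun θ => ∑ x ∈ S, p x * Real.exp (θ * Y x) with hM
  have hM0 : ∀ θ, 0 ≤ M θ := fun θ =>
    sum_nonneg fun x hx => mul_nonneg (hp x hx) (Real.exp_pos _).le
  -- on `[0, 1/2]` the factor `1 - (e^{θ/2} - 1)²` is at least `1 - 0.324 θ² ≥ exp (-b₀ θ²)`
  set b₀ : ℝ := 4 * 0.081 / 0.919 with hb₀
  have hstep : ∀ B : ℝ, (∀ θ, 0 ≤ θ → θ ≤ 1 / 2 → M θ ≤ Real.exp (B * θ ^ 2)) →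
      ∀ θ, 0 ≤ θ → θ ≤ 1 / 2 → M θ ≤ Real.exp ((B / 2 + b₀) * θ ^ 2) := by
    intro B hB θ h0 h1
    have hr := hrec θ h0 (by linarith)
    have ha : (Real.exp (θ / 2) - 1) ^ 2 ≤ 4 * 0.081 * θ ^ 2 := by
      have hc := exp_mul_sub_one_le (b := 1 / 4) (r := 2 * θ) (by linarith) (by linarith)
      rw [show 2 * θ * (1 / 4) = θ / 2 by ring] at hc
      have hn : 0 ≤ Real.exp (θ / 2) - 1 := by linarith [Real.add_one_le_exp (θ / 2)]
      calc (Real.exp (θ / 2) - 1) ^ 2 ≤ (2 * θ * (Real.exp (1 / 4) - 1)) ^ 2 :=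
            pow_le_pow_left₀ hn hc 2
        _ = 4 * (Real.exp (1 / 4) - 1) ^ 2 * θ ^ 2 := by ring
        _ ≤ _ := by nlinarith [exp_quarter_sub_one_sq_le, sq_nonneg θ]
    have hM2 : M (θ / 2) ^ 2 ≤ Real.exp (B / 2 * θ ^ 2) := by
      refine (pow_le_pow_left₀ (hM0 _) (hB (θ / 2) (by linarith) (by linarith)) 2).trans_eq ?_
      rw [← Real.exp_nat_mul]
      congr 1
      push_cast
      ring
    have hθ2 : θ ^ 2 ≤ 1 / 4 := by nlinarith
    have he : (1 - 4 * 0.081 * θ ^ 2) * Real.exp (b₀ * θ ^ 2) ≥ 1 := by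
      have h2 := Real.add_one_le_exp (b₀ * θ ^ 2)
      have h3 : 0 < 1 - 4 * 0.081 * θ ^ 2 := by nlinarith
      refine le_trans ?_ (mul_le_mul_of_nonneg_left h2 h3.le)
      rw [hb₀]
      nlinarith [sq_nonneg θ, mul_nonneg (sq_nonneg θ) (sub_nonneg.2 hθ2)]
    have hr' : M θ - M (θ / 2) ^ 2 ≤ (Real.exp (θ / 2) - 1) ^ 2 * M θ := hr
    have h4 : M θ * (1 - 4 * 0.081 * θ ^ 2) ≤ Real.exp (B / 2 * θ ^ 2) := by
      nlinarith [mul_le_mul_of_nonneg_right ha (hM0 θ)]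
    calc M θ ≤ M θ * ((1 - 4 * 0.081 * θ ^ 2) * Real.exp (b₀ * θ ^ 2)) :=
          le_mul_of_one_le_right (hM0 θ) he
      _ = M θ * (1 - 4 * 0.081 * θ ^ 2) * Real.exp (b₀ * θ ^ 2) := by ring
      _ ≤ Real.exp (B / 2 * θ ^ 2) * Real.exp (b₀ * θ ^ 2) :=
          mul_le_mul_of_nonneg_right h4 (Real.exp_pos _).le
      _ = _ := by rw [← Real.exp_add, ← add_mul]
  -- some constant is available to start with, since the sum is finite and `Y` is centred
  obtain ⟨B, hB⟩ : ∃ B : ℝ, ∀ θ, 0 ≤ θ → θ ≤ 1 / 2 → M θ ≤ Real.exp (B * θ ^ 2) := by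
    refine ⟨∑ x ∈ S, p x * (Y x ^ 2 * Real.exp |Y x|), fun θ h0 h1 => ?_⟩
    refine le_trans ?_ (Real.add_one_le_exp _)
    have : ∀ x ∈ S, p x * Real.exp (θ * Y x) ≤
        p x + θ * (p x * Y x) + p x * (Y x ^ 2 * Real.exp |Y x|) * θ ^ 2 := by
      intro x hx
      have h2 := exp_le_one_add_self_add_sq_mul_exp_abs (θ * Y x)
      have h3 : Real.exp |θ * Y x| ≤ Real.exp |Y x| := by
        rw [abs_mul, abs_of_nonneg h0]
        exact Real.exp_le_exp.2 (mul_le_of_le_one_left (abs_nonneg _) (by linarith))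
      have h4 := mul_le_mul_of_nonneg_left h3 (sq_nonneg (θ * Y x))
      nlinarith [mul_le_mul_of_nonneg_left (h2.trans (add_le_add_right h4 _)) (hp x hx)]
    refine (sum_le_sum this).trans_eq ?_
    rw [sum_add_distrib, sum_add_distrib, hp1, ← mul_sum, hY, ← sum_mul]
    ring
  have hiter : ∀ n : ℕ, ∀ θ, 0 ≤ θ → θ ≤ 1 / 2 →
      M θ ≤ Real.exp ((2 * b₀ + (B - 2 * b₀) * (1 / 2) ^ n) * θ ^ 2) := by
    intro n
    induction n with
    | zero => simpa using hB
    | succ n ih =>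
      intro θ h0 h1
      refine (hstep _ ih θ h0 h1).trans_eq ?_
      congr 1
      ring
  have hhalf : M (1 / 2) ≤ Real.exp (2 * b₀ * (1 / 2) ^ 2) := by
    have hlim : Filter.Tendsto
        (fun n : ℕ => Real.exp ((2 * b₀ + (B - 2 * b₀) * (1 / 2) ^ n) * (1 / 2) ^ 2))
        Filter.atTop (nhds (Real.exp ((2 * b₀ + (B - 2 * b₀) * 0) * (1 / 2) ^ 2))) :=
      (Real.continuous_exp.tendsto _).comp ((((tendsto_pow_atTop_nhds_zero_of_lt_one
        (by norm_num) (by norm_num)).const_mul _).const_add _).mul_const _)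
    rw [mul_zero, add_zero] at hlim
    exact ge_of_tendsto' hlim fun n => hiter n _ (by norm_num) le_rfl
  -- the step from `1/2` to `1` uses the recursion itself, whose constant is larger there
  have hb₀' : M (1 / 2) ^ 2 ≤ 1.4275 := by
    have h1 : M (1 / 2) ^ 2 ≤ Real.exp b₀ := by
      refine (pow_le_pow_left₀ (hM0 _) hhalf 2).trans_eq ?_
      rw [← Real.exp_nat_mul]
      congr 1
      push_cast
      ring
    have h2 : Real.exp b₀ ≤ 1.4275 := by
      have := Real.exp_bound' (x := b₀) (by norm_num [hb₀]) (by norm_num [hb₀]) (n := 4)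
        (by norm_num)
      refine this.trans ?_
      norm_num [hb₀, Finset.sum_range_succ, Nat.factorial]
    linarith
  have h1 : M 1 - M (1 / 2) ^ 2 ≤ (Real.exp (1 / 2) - 1) ^ 2 * M 1 := hrec 1 zero_le_one le_rfl
  have h2 := mul_le_mul_of_nonneg_right exp_half_sub_one_sq_le (hM0 1)
  have h3 : M 1 ≤ 5 / 2 := by linarith
  simpa [hM] using h3

open Classical in
/-- A centred random variable with variance at most `1` and `E e^Y ≤ 5/2` has
`P(Y ≥ τ) ≤ 2 e^{-τ}`. Up to `τ = 11/4` this is Cantelli's inequality, and beyond it Markov's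
inequality for `e^Y - 1 - Y`. -/
theorem sum_filter_le_two_mul_exp_neg (hp : ∀ x ∈ S, 0 ≤ p x) (hp1 : ∑ x ∈ S, p x = 1)
    (hY : ∑ x ∈ S, p x * Y x = 0) (hY2 : ∑ x ∈ S, p x * Y x ^ 2 ≤ 1)
    (hexp : ∑ x ∈ S, p x * Real.exp (Y x) ≤ 5 / 2) (τ : ℝ) :
    ∑ x ∈ S with τ ≤ Y x, p x ≤ 2 * Real.exp (-τ) := by
  have markov : ∀ (φ : α → ℝ) (m : ℝ), (∀ x ∈ S, 0 ≤ φ x) → (∀ x ∈ S, τ ≤ Y x → m ≤ φ x) →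
      (∑ x ∈ S with τ ≤ Y x, p x) * m ≤ ∑ x ∈ S, p x * φ x := by
    intro φ m h0 hm
    rw [sum_mul]
    calc ∑ x ∈ S with τ ≤ Y x, p x * m ≤ ∑ x ∈ S with τ ≤ Y x, p x * φ x :=
          sum_le_sum fun x hx =>
            mul_le_mul_of_nonneg_left (hm x (mem_filter.1 hx).1 (mem_filter.1 hx).2)
              (hp x (mem_filter.1 hx).1)
      _ ≤ _ := sum_le_sum_of_subset_of_nonneg (filter_subset _ _) fun x hx _ =>
            mul_nonneg (hp x hx) (h0 x hx)
  rcases le_total τ (11 / 4) with hτ | hτ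
  · rcases le_total τ 0 with h0 | h0
    · have h1 : ∑ x ∈ S with τ ≤ Y x, p x ≤ 1 := by
        rw [← hp1]
        exact sum_le_sum_of_subset_of_nonneg (filter_subset _ _) fun x hx _ => hp x hx
      have h2 : 1 ≤ Real.exp (-τ) := Real.one_le_exp (by linarith)
      linarith
    · refine le_trans ?_ (inv_one_add_sq_le_two_mul_exp_neg hτ)
      -- Cantelli: this square is the optimal quadratic majorant of the event
      have h1 := markov (fun x => (1 + τ * Y x) ^ 2) ((1 + τ ^ 2) ^ 2) (fun x _ => sq_nonneg _)
        fun x _ hx => pow_le_pow_left₀ (by positivity) (by nlinarith) 2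
      have h2 : ∑ x ∈ S, p x * (1 + τ * Y x) ^ 2 =
          ∑ x ∈ S, p x + 2 * τ * ∑ x ∈ S, p x * Y x + τ ^ 2 * ∑ x ∈ S, p x * Y x ^ 2 := by
        rw [mul_sum, mul_sum, ← sum_add_distrib, ← sum_add_distrib]
        exact sum_congr rfl fun x _ => by ring
      have h3 : 0 < 1 + τ ^ 2 := by positivity
      rw [h2, hp1, hY] at h1
      rw [le_div_iff₀ h3]
      have h4 : (∑ x ∈ S with τ ≤ Y x, p x) * (1 + τ ^ 2) * (1 + τ ^ 2) ≤ 1 * (1 + τ ^ 2) := by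
        nlinarith [mul_le_mul_of_nonneg_left hY2 (sq_nonneg τ)]
      exact le_of_mul_le_mul_right h4 h3
  · have h1 := markov (fun x => Real.exp (Y x) - 1 - Y x) (Real.exp τ - 1 - τ)
      (fun x _ => by linarith [Real.add_one_le_exp (Y x)]) fun x _ hx => by
        have h2 : Real.exp (Y x) = Real.exp τ * Real.exp (Y x - τ) := by
          rw [← Real.exp_add]; congr 1; ring
        have h3 := Real.add_one_le_exp (Y x - τ)
        have h4 : 1 ≤ Real.exp τ := Real.one_le_exp (by linarith)
        nlinarith
    have h2 : ∑ x ∈ S, p x * (Real.exp (Y x) - 1 - Y x) ≤ 3 / 2 := by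
      have : ∑ x ∈ S, p x * (Real.exp (Y x) - 1 - Y x) =
          ∑ x ∈ S, p x * Real.exp (Y x) - ∑ x ∈ S, p x - ∑ x ∈ S, p x * Y x := by
        rw [← sum_sub_distrib, ← sum_sub_distrib]
        exact sum_congr rfl fun x _ => by ring
      rw [this, hp1, hY]
      linarith
    have h3 := four_add_four_mul_le_exp hτ
    set P := ∑ x ∈ S with τ ≤ Y x, p x with hP
    have hP0 : 0 ≤ P := sum_nonneg fun x hx => hp x (mem_filter.1 hx).1
    rw [Real.exp_neg, ← div_eq_mul_inv, le_div_iff₀ (Real.exp_pos _)]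
    nlinarith

end Tail

/-! ### Concentration of Lipschitz functions -/

theorem exp_half_mul_sub_one_le {θ δ : ℝ} (h0 : 0 ≤ δ) (h1 : δ ≤ 1) :
    Real.exp (θ / 2 * δ) - 1 ≤ δ * (Real.exp (θ / 2) - 1) ∧
      1 - Real.exp (-(θ / 2 * δ)) ≤ δ * (Real.exp (θ / 2) - 1) := by
  have h2 : Real.exp (θ / 2 * δ) - 1 ≤ δ * (Real.exp (θ / 2) - 1) := by
    have := exp_mul_sub_one_le (b := θ / 2) h0 h1
    rwa [mul_comm δ (θ / 2)] at this
  refine ⟨h2, le_trans ?_ h2⟩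
  linarith [Real.add_one_le_exp (θ / 2 * δ), Real.add_one_le_exp (-(θ / 2 * δ))]

namespace WeightedComplex

variable {V : Type*} [DecidableEq V] {d : ℕ} {X : WeightedComplex V d}

/-- The exponential of a Lipschitz function, in either direction (`ε = ± 1`). The one-sided
Lipschitz condition controls the decrements `δ` of `f`; these decrease `e^{θ f / 2}` and
`-e^{-θ f / 2}`, and each is at most `1` after the normalization by `√(c ν)`. -/
theorem IsLipschitz.resampleBound_exp {k : ℕ} {ν c : ℝ} {f : Finset V → ℝ}
    (hf : X.IsLipschitz k ν f) (hν : 0 < ν) (hc : 1 ≤ c) {θ : ℝ} (hθ : 0 ≤ θ) (a : ℝ) {ε : ℝ}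
    (hε : ε = 1 ∨ ε = -1) :
    X.ResampleBound k
      (fun s => (Real.exp (θ / 2) - 1) ^ 2 / c * Real.exp (θ * (ε * (f s - a) / √(c * ν))))
      (fun s => ε * Real.exp (θ / 2 * (ε * (f s - a) / √(c * ν)))) := by
  intro s hs z hz
  have hcν : 0 < c * ν := by positivity
  have hr : 0 < √(c * ν) := Real.sqrt_pos.2 hcν
  have hr2 : √(c * ν) ^ 2 = c * ν := Real.sq_sqrt hcν.le
  have hL := hf.resampleBound s hs z hz
  set r := √(c * ν)
  set e := Real.exp (θ / 2) - 1 with he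
  have he0 : 0 ≤ e := by linarith [Real.add_one_le_exp (θ / 2)]
  set E := Real.exp (θ / 2 * (ε * (f s - a) / r)) with hE
  have hE0 : 0 < E := Real.exp_pos _
  have hE2 : Real.exp (θ * (ε * (f s - a) / r)) = E ^ 2 := by
    rw [hE, ← Real.exp_nat_mul]
    congr 1
    push_cast
    ring
  have hx : ∀ x ∈ s, max (ε * E -
      ε * Real.exp (θ / 2 * (ε * (f (insert (z x) (s.erase x)) - a) / r))) 0 ≤
        E * e / r * max (f s - f (insert (z x) (s.erase x))) 0 := by
    intro x hx
    have hterm : max (f s - f (insert (z x) (s.erase x))) 0 ^ 2 ≤ ν :=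
      (single_le_sum (f := fun x => max (f s - f (insert (z x) (s.erase x))) 0 ^ 2)
        (fun _ _ => sq_nonneg _) hx).trans hL
    set f' := f (insert (z x) (s.erase x))
    have hsplit : ∀ ε' : ℝ, Real.exp (θ / 2 * (ε' * (f' - a) / r)) =
        Real.exp (θ / 2 * (ε' * (f s - a) / r)) *
          Real.exp (-(θ / 2 * (ε' * ((f s - f') / r)))) := fun ε' => by
      rw [← Real.exp_add]
      congr 1
      ring
    rw [hsplit, ← hE]
    rcases le_total (f s) f' with hle | hle
    · rw [max_eq_right (sub_nonpos.2 hle), mul_zero]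
      refine max_le ?_ le_rfl
      have hδ : 0 ≤ θ / 2 * -((f s - f') / r) :=
        mul_nonneg (by linarith) (neg_nonneg.2 (div_nonpos_of_nonpos_of_nonneg
          (sub_nonpos.2 hle) hr.le))
      rcases hε with rfl | rfl
      · have : 1 ≤ Real.exp (-(θ / 2 * (1 * ((f s - f') / r)))) :=
          Real.one_le_exp (by linarith)
        nlinarith
      · have : Real.exp (-(θ / 2 * (-1 * ((f s - f') / r)))) ≤ 1 :=
          Real.exp_le_one_iff.2 (by linarith)
        nlinarith
    · rw [max_eq_left (sub_nonneg.2 hle)] at hterm ⊢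
      have hd0 : 0 ≤ (f s - f') / r := div_nonneg (sub_nonneg.2 hle) hr.le
      have hd1 : (f s - f') / r ≤ 1 := by
        rw [div_le_one hr]
        refine le_of_sq_le_sq ?_ hr.le
        rw [hr2]
        nlinarith
      obtain ⟨h1, h2⟩ := exp_half_mul_sub_one_le (θ := θ) hd0 hd1
      have e1 : E * e / r * (f s - f') = E * ((f s - f') / r * e) := by ring
      rw [e1]
      refine max_le ?_ (by positivity)
      rcases hε with rfl | rfl
      · rw [one_mul, one_mul, one_mul, ← mul_one_sub]
        exact mul_le_mul_of_nonneg_left h2 hE0.le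
      · rw [neg_one_mul ((f s - f') / r), mul_neg, neg_neg]
        have := mul_le_mul_of_nonneg_left h1 hE0.le
        linarith
  have hsum : ∑ x ∈ s, (max (ε * E -
      ε * Real.exp (θ / 2 * (ε * (f (insert (z x) (s.erase x)) - a) / r))) 0) ^ 2 ≤
      (E * e / r) ^ 2 * ∑ x ∈ s, max (f s - f (insert (z x) (s.erase x))) 0 ^ 2 := by
    rw [mul_sum]
    refine sum_le_sum fun x hxs => ?_
    rw [← mul_pow]
    exact pow_le_pow_left₀ (le_max_right _ _) (hx x hxs) 2
  refine hsum.trans ((mul_le_mul_of_nonneg_left hL (sq_nonneg _)).trans_eq ?_)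
  simp only [hE2, div_pow, hr2]
  field_simp

open Classical in
/-- Both tails (`ε = ± 1`) of a Lipschitz function on `X(k)`. -/
theorem HasPoincare.sum_prob_le {c : ℝ} (hX : X.HasPoincare c) (hc : 1 ≤ c) {k : ℕ} (hk : k ≤ d)
    {ν : ℝ} (hν : 0 < ν) {f : Finset V → ℝ} (hf : X.IsLipschitz k ν f) {ε : ℝ}
    (hε : ε = 1 ∨ ε = -1) (τ : ℝ) :
    ∑ s ∈ X.faces k with τ ≤ ε * (f s - X.mean k f) / √(c * ν), X.prob s ≤
      2 * Real.exp (-τ) := by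
  have hcν : 0 < c * ν := by positivity
  have hr2 : √(c * ν) ^ 2 = c * ν := Real.sq_sqrt hcν.le
  have hε2 : ε ^ 2 = 1 := by rcases hε with rfl | rfl <;> norm_num
  have hone : ∀ b : ℝ, X.mean k (fun _ => b) = b := fun b => by
    rw [mean, ← sum_mul, sum_prob hk, one_mul]
  set m := X.mean k f with hm
  have hY : ∑ s ∈ X.faces k, X.prob s * (ε * (f s - m) / √(c * ν)) = 0 := by
    have : X.mean k (fun s => ε / √(c * ν) * (f s - m)) = 0 := by
      rw [mean_const_mul, mean_sub, hone, ← hm, sub_self, mul_zero]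
    rw [← this, mean]
    exact sum_congr rfl fun s _ => by ring
  have hY2 : ∑ s ∈ X.faces k, X.prob s * (ε * (f s - m) / √(c * ν)) ^ 2 ≤ 1 := by
    have h1 := hX.variance_le hc hk hf.resampleBound
    rw [hone] at h1
    have h2 : ∑ s ∈ X.faces k, X.prob s * (ε * (f s - m) / √(c * ν)) ^ 2 =
        (X.mean k (fun s => f s ^ 2) - m ^ 2) / (c * ν) := by
      have h3 : X.mean k (fun s => f s ^ 2) - m ^ 2 = X.mean k fun s => (f s - m) ^ 2 := by
        have h4 : (fun s => (f s - m) ^ 2) = fun s => f s ^ 2 - (2 * m * f s - m ^ 2) := by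
          funext s
          ring
        rw [h4, mean_sub, mean_sub, mean_const_mul, hone, ← hm]
        ring
      rw [h3, mean, sum_div]
      refine sum_congr rfl fun s _ => ?_
      rw [div_pow, mul_pow, hε2, hr2]
      ring
    rw [h2, div_le_one hcν]
    exact h1
  refine sum_filter_le_two_mul_exp_neg (fun s _ => prob_nonneg s) (sum_prob hk) hY hY2
    (sum_mul_exp_le_of_recursion (fun s _ => prob_nonneg s) (sum_prob hk) hY
      fun θ hθ _ => ?_) τ
  have h1 := hX.variance_le hc hk (hf.resampleBound_exp hν hc hθ m hε)
  rw [mean_const_mul, mean_const_mul, mul_pow, hε2, one_mul, ← mul_assoc,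
    mul_div_cancel₀ _ (by linarith : c ≠ 0)] at h1
  have h2 : X.mean k (fun s => (ε * Real.exp (θ / 2 * (ε * (f s - m) / √(c * ν)))) ^ 2) =
      ∑ s ∈ X.faces k, X.prob s * Real.exp (θ * (ε * (f s - m) / √(c * ν))) := by
    refine sum_congr rfl fun s _ => ?_
    simp only [mul_pow, hε2, one_mul, ← Real.exp_nat_mul]
    congr 2
    push_cast
    ring
  rw [h2] at h1
  exact h1

theorem HasPoincare.probOf_le {c : ℝ} (hX : X.HasPoincare c) (hc : 1 ≤ c) {k : ℕ} (hk : k ≤ d)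
    {ν : ℝ} (hν : 0 < ν) {f : Finset V → ℝ} (hf : X.IsLipschitz k ν f) (t : ℝ) :
    X.probOf k (fun s => f s - X.mean k f ≥ t) ≤ 2 * Real.exp (-t / √(c * ν)) ∧
      X.probOf k (fun s => f s - X.mean k f ≤ -t) ≤ 2 * Real.exp (-t / √(c * ν)) := by
  have hr : 0 < √(c * ν) := Real.sqrt_pos.2 (by positivity)
  have h1 := hX.sum_prob_le hc hk hν hf (Or.inl rfl) (t / √(c * ν))
  have h2 := hX.sum_prob_le hc hk hν hf (Or.inr rfl) (t / √(c * ν))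
  simp only [div_le_div_iff_of_pos_right hr, one_mul, neg_one_mul, le_neg (a := t)] at h1 h2
  rw [neg_div]
  exact ⟨h1, h2⟩

end WeightedComplex

end

theorem mainTheorem5 {V : Type*} [DecidableEq V] {d : ℕ} (X : WeightedComplex V d) :
    (∀ lam : ℝ, lam < 1 → X.IsTricklingDown lam →
      ∀ k : ℕ, k ≤ d → ∀ ν : ℝ, 0 < ν → ∀ f : Finset V → ℝ, X.IsLipschitz k ν f → ∀ t : ℝ,
        X.probOf k (fun s => f s - X.mean k f ≥ t) ≤
            2 * Real.exp (-t / Real.sqrt ((1 + Real.exp (lam / (1 - lam))) * ν)) ∧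
        X.probOf k (fun s => f s - X.mean k f ≤ -t) ≤
            2 * Real.exp (-t / Real.sqrt ((1 + Real.exp (lam / (1 - lam))) * ν))) ∧
    (∀ C : ℝ, 0 < C → SecondEigenvalueLE (X.faces d) X.prob (X.downUp d) (1 - 1 / (C * d)) →
      ∀ k : ℕ, k ≤ d → ∀ ν : ℝ, 0 < ν → ∀ f : Finset V → ℝ, X.IsLipschitz k ν f → ∀ t : ℝ,
        X.probOf k (fun s => f s - X.mean k f ≥ t) ≤
            2 * Real.exp (-t / Real.sqrt ((C + 1) * ν)) ∧
        X.probOf k (fun s => f s - X.mean k f ≤ -t) ≤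
            2 * Real.exp (-t / Real.sqrt ((C + 1) * ν))) :=
  ⟨fun _ hlam h _ hk _ hν _ hf t =>
    (h.hasPoincare hlam).probOf_le (le_add_of_nonneg_right (Real.exp_pos _).le) hk hν hf t,
  fun _ hC h _ hk _ hν _ hf t =>
    (WeightedComplex.hasPoincare_of_secondEigenvalueLE hC h).probOf_le (by linarith) hk hν hf t⟩
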